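/- Let $m\ge 0$, let $N^{m+1}$ be an $(m+1)$-dimensional smooth Riemannian manifold all of whose sectional curvatures are equal to a constant $c\in\mathbb R$ (a space form), and let $\varphi: M^m\to N^{m+1}$ be a hypersurface, that is, a smooth isometric immersion of an $m$-dimensional smooth Riemannian manifold $M$, with a smooth unit normal vector field $\eta$ along $\varphi$. Let $A$ be the shape operator associated with $\eta$, so that $A(X)$ is the tangential component of $-\nabla^{\varphi}_X\eta$, where $\nabla^\varphi$ is the connection on $\varphi^{-1}(TN)$ induced by the Levi-Civita connection of $N$. Let $f$ be the mean curvature function, $f=\frac1m\operatorname{tr}A$ (with $f=0$ if $m=0$), and let $|A|^2=\operatorname{tr}A^2$. Define \[ \psi_3=\tfrac16 m^3f^3+\tfrac13\operatorname{tr}A^3-\tfrac12 mf|A|^2,\qquad \psi_2=\tfrac12\left(m^2f^2-|A|^2\right), \] and let $\phi$ be the $(1,1)$-tensor field on $M$ given by \[ \phi=\psi_3\,\mathrm{Id}-\psi_2A+mfA^2-A^3 . \] Then $\operatorname{div}\phi=0$ on $M$, where, for a $(1,1)$-tensor field $T$ on $M$, $\operatorname{div}T=\sum_i(\nabla_{E_i}T)(E_i)$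 for an orthonormal frame $\{E_i\}$, with $\nabla$ the Levi-Civita connection of $M$. -/

import Mathlib

open Bundle Manifold
open scoped ContDiff

noncomputable section

namespace RiemannianGeometry

section Intrinsic

/- `M` is a manifold modelled on the finite-dimensional space `E`, with an inner product
`inner ℝ` on each tangent space (the Riemannian metric). -/
variable {E : Type*} [NormedAddCommGroup E] [NormedSpace ℝ E] [FiniteDimensional ℝ E]
  {H : Type*} [TopologicalSpace H] (I : ModelWithCorners ℝ E H)
  {M : Type*} [TopologicalSpace M] [ChartedSpace H M] [IsManifold I ∞ M]

instance finiteDimensional_tangentSpace (x : M) : FiniteDimensional ℝ (TangentSpace I x) :=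
  inferInstanceAs (FiniteDimensional ℝ E)

/-- A smooth extension of a tangent vector `v` at `x` to a vector field near `x`: the field whose
components in the preferred chart at `x` are constant. -/
def extendVec {x : M} (v : TangentSpace I x) : Π y : M, TangentSpace I y :=
  FiberBundle.extend E v

/-- The trace of an endomorphism of the tangent space at `x`. -/
def tangentTrace {x : M} (T : TangentSpace I x →L[ℝ] TangentSpace I x) : ℝ :=
  LinearMap.trace ℝ (TangentSpace I x) (T : TangentSpace I x →ₗ[ℝ] TangentSpace I x)

variable [RiemannianBundle (fun x : M ↦ TangentSpace I x)]

/-- An orthonormal basis of the tangent space at `x`. -/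
def tangentONB (x : M) :
    OrthonormalBasis (Fin (Module.finrank ℝ (TangentSpace I x))) ℝ (TangentSpace I x) :=
  stdOrthonormalBasis ℝ (TangentSpace I x)

/-- The right-hand side of the Koszul formula,
`½ (X⟨Y,Z⟩ + Y⟨X,Z⟩ - Z⟨X,Y⟩ + ⟨[X,Y],Z⟩ - ⟨[X,Z],Y⟩ - ⟨[Y,Z],X⟩)`, at the point `x`. -/
def koszul (X Y Z : Π y : M, TangentSpace I y) (x : M) : ℝ :=
  (1 / 2 : ℝ) *
    (mvfderiv I (fun y ↦ inner ℝ (Y y) (Z y)) x (X x)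
      + mvfderiv I (fun y ↦ inner ℝ (X y) (Z y)) x (Y x)
      - mvfderiv I (fun y ↦ inner ℝ (X y) (Y y)) x (Z x)
      + inner ℝ (VectorField.mlieBracket I X Y x) (Z x)
      - inner ℝ (VectorField.mlieBracket I X Z x) (Y x)
      - inner ℝ (VectorField.mlieBracket I Y Z x) (X x))

/-- The Levi-Civita connection of `M`, given by the Koszul formula: `leviCivita I Y x v` is
`∇_v Y`, the vector at `x` with `⟨∇_v Y, Z⟩ = koszul(v, Y, Z)`. -/
def leviCivita (Y : Π y : M, TangentSpace I y) (x : M) :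
    TangentSpace I x →L[ℝ] TangentSpace I x :=
  ∑ i, ∑ j,
    koszul I (extendVec I (tangentONB I x i)) Y (extendVec I (tangentONB I x j)) x •
      (innerSL ℝ (tangentONB I x i)).smulRight (tangentONB I x j)

/-- The curvature tensor `R(u, v) w = ∇_u ∇_v w - ∇_v ∇_u w - ∇_[u,v] w` at `x`. -/
def curvature (x : M) (u v w : TangentSpace I x) : TangentSpace I x :=
  leviCivita I (fun y ↦ leviCivita I (extendVec I w) y (extendVec I v y)) x u
    - leviCivita I (fun y ↦ leviCivita I (extendVec I w) y (extendVec I u y)) x v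
    - leviCivita I (extendVec I w) x
        (VectorField.mlieBracket I (extendVec I u) (extendVec I v) x)

/-- The sectional curvature of the plane spanned by the linearly independent vectors `u`, `v`. -/
def sectionalCurvature (x : M) (u v : TangentSpace I x) : ℝ :=
  inner ℝ (curvature I x u v v) u /
    (inner ℝ u u * inner ℝ v v - inner ℝ u v ^ 2)

variable (M) in
/-- All sectional curvatures of `M` are equal to `c`. -/
def HasConstantSectionalCurvature (c : ℝ) : Prop :=
  ∀ (x : M) (u v : TangentSpace I x), LinearIndependent ℝ ![u, v] →
    sectionalCurvature I x u v = c

/-- The covariant derivative of a `(1,1)`-tensor field `T`: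
`(∇_v T)(w) = ∇_v (T w) - T (∇_v w)`. -/
def covDerivTensor (T : Π y : M, TangentSpace I y →L[ℝ] TangentSpace I y) (x : M)
    (v w : TangentSpace I x) : TangentSpace I x :=
  leviCivita I (fun y ↦ T y (extendVec I w y)) x v - T x (leviCivita I (extendVec I w) x v)

/-- The divergence of a `(1,1)`-tensor field `T`: the metric trace `∑ᵢ (∇_{eᵢ} T)(eᵢ)`. -/
def divTensor (T : Π y : M, TangentSpace I y →L[ℝ] TangentSpace I y) (x : M) :
    TangentSpace I x :=
  ∑ i, covDerivTensor I T x (tangentONB I x i) (tangentONB I x i)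

end Intrinsic

section Hypersurface

variable {E : Type*} [NormedAddCommGroup E] [NormedSpace ℝ E] [FiniteDimensional ℝ E]
  {H : Type*} [TopologicalSpace H] (I : ModelWithCorners ℝ E H)
  {M : Type*} [TopologicalSpace M] [ChartedSpace H M] [IsManifold I ∞ M]
  [RiemannianBundle (fun x : M ↦ TangentSpace I x)]
  {E' : Type*} [NormedAddCommGroup E'] [NormedSpace ℝ E'] [FiniteDimensional ℝ E']
  {H' : Type*} [TopologicalSpace H'] (J : ModelWithCorners ℝ E' H')
  {N : Type*} [TopologicalSpace N] [ChartedSpace H' N] [IsManifold J ∞ N]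
  [RiemannianBundle (fun x : N ↦ TangentSpace J x)]

/-- `φ : M → N` is a smooth isometric immersion: `⟨dφ v, dφ w⟩ = ⟨v, w⟩`. -/
structure IsIsometricImmersion (φ : M → N) : Prop where
  contMDiff : ContMDiff I J ∞ φ
  inner_mfderiv : ∀ (x : M) (v w : TangentSpace I x),
    inner ℝ (mfderiv I J φ x v) (mfderiv I J φ x w) = inner ℝ v w

/-- `η` is a smooth unit normal vector field along `φ : M → N`. -/
structure IsUnitNormal (φ : M → N) (η : Π x : M, TangentSpace J (φ x)) : Prop where
  contMDiff : ContMDiff I J.tangent ∞ (fun x ↦ (⟨φ x, η x⟩ : TangentBundle J N))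
  inner_self : ∀ x, inner ℝ (η x) (η x) = 1
  inner_mfderiv : ∀ (x : M) (v : TangentSpace I x), inner ℝ (η x) (mfderiv I J φ x v) = 0

/-- The connection `∇^φ` on `φ⁻¹(TN)` induced by the Levi-Civita connection of `N`. If
`σ = ∑ₐ σᵃ (∂ₐ ∘ φ)` near `x`, with `∂ₐ` the coordinate frame of the preferred chart of `N` at
`φ x`, then `∇^φ_v σ = ∑ₐ dσᵃ(v) ∂ₐ + ∑ₐ σᵃ(x) ∇_{dφ v} ∂ₐ`. -/
def pullbackConnection (φ : M → N) (σ : Π x : M, TangentSpace J (φ x)) (x : M) :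
    TangentSpace I x →L[ℝ] TangentSpace J (φ x) :=
  ((trivializationAt E' (TangentSpace J : N → Type _) (φ x)).symmL ℝ (φ x)).comp
      (mvfderiv I
        (fun y ↦ (trivializationAt E' (TangentSpace J : N → Type _) (φ x) ⟨φ y, σ y⟩).2) x)
    + (leviCivita J (extendVec J (σ x)) (φ x)).comp (mfderiv I J φ x)

/-- The shape operator `A = A_η`: `A v` is the tangential component of `-∇^φ_v η`, i.e. the vector
with `⟨A v, w⟩ = -⟨∇^φ_v η, dφ w⟩`. -/
def shapeOperator (φ : M → N) (η : Π x : M, TangentSpace J (φ x)) (x : M) :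
    TangentSpace I x →L[ℝ] TangentSpace I x :=
  -∑ i, ((innerSL ℝ (mfderiv I J φ x (tangentONB I x i))).comp
      (pullbackConnection I J φ η x)).smulRight (tangentONB I x i)

end Hypersurface

end RiemannianGeometry

end

noncomputable section

open scoped Topology

set_option maxSynthPendingDepth 3

namespace RiemannianGeometry

section NewtonTransformation

variable {V : Type*} [NormedAddCommGroup V] [NormedSpace ℝ V]

/-- The trace of a continuous endomorphism. -/
def clmTrace (T : V →L[ℝ] V) : ℝ := LinearMap.trace ℝ V (T : V →ₗ[ℝ] V)

lemma clmTrace_add (S T : V →L[ℝ] V) : clmTrace (S + T) = clmTrace S + clmTrace T := by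
  simp [clmTrace]

lemma clmTrace_sub (S T : V →L[ℝ] V) : clmTrace (S - T) = clmTrace S - clmTrace T := by
  simp [clmTrace]

lemma clmTrace_mul_comm (S T : V →L[ℝ] V) : clmTrace (S * T) = clmTrace (T * S) :=
  LinearMap.trace_mul_comm ℝ (S : V →ₗ[ℝ] V) (T : V →ₗ[ℝ] V)

/-- The trace as a continuous linear functional on endomorphisms. -/
def clmTraceL [FiniteDimensional ℝ V] : (V →L[ℝ] V) →L[ℝ] ℝ :=
  LinearMap.toContinuousLinearMap
    (LinearMap.trace ℝ V ∘ₗ ContinuousLinearMap.coeLM ℝ)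

lemma clmTraceL_apply [FiniteDimensional ℝ V] (T : V →L[ℝ] V) : clmTraceL T = clmTrace T := rfl

/-- The second elementary symmetric function of the eigenvalues. -/
def newtonSigma₂ (A : V →L[ℝ] V) : ℝ := (1 / 2 : ℝ) * (clmTrace A ^ 2 - clmTrace (A * A))

/-- The third elementary symmetric function of the eigenvalues. -/
def newtonSigma₃ (A : V →L[ℝ] V) : ℝ :=
  (1 / 6 : ℝ) * clmTrace A ^ 3 + (1 / 3 : ℝ) * clmTrace (A * A * A)
    - (1 / 2 : ℝ) * clmTrace A * clmTrace (A * A)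

/-- The third Newton transformation of an endomorphism. -/
def newtonTransformation₃ (A : V →L[ℝ] V) : V →L[ℝ] V :=
  newtonSigma₃ A • 1 - newtonSigma₂ A • A + clmTrace A • (A * A) - A * A * A

/-- The derivative of `newtonTransformation₃` at `A` in the direction `B`. -/
def newtonTransformation₃Deriv (A B : V →L[ℝ] V) : V →L[ℝ] V :=
  (newtonSigma₂ A * clmTrace B - clmTrace A * clmTrace (A * B) + clmTrace (A * A * B)) • 1
    - (clmTrace A * clmTrace B - clmTrace (A * B)) • A - newtonSigma₂ A • B
    + clmTrace B • (A * A) + clmTrace A • (B * A + A * B)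
    - (B * A * A + A * B * A + A * A * B)

lemma newtonTransformation₃Deriv_add_commutator (A B G : V →L[ℝ] V) :
    newtonTransformation₃Deriv A (B + (G * A - A * G))
      = newtonTransformation₃Deriv A B
        + (G * newtonTransformation₃ A - newtonTransformation₃ A * G) := by
  have h1 : clmTrace (B + (G * A - A * G)) = clmTrace B := by
    rw [clmTrace_add, clmTrace_sub, clmTrace_mul_comm G A]; ring
  have h2 : clmTrace (A * (B + (G * A - A * G))) = clmTrace (A * B) := by
    rw [mul_add, mul_sub, clmTrace_add, clmTrace_sub, ← mul_assoc, ← mul_assoc,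
      clmTrace_mul_comm (A * G) A, ← mul_assoc]; ring
  have h3 : clmTrace (A * A * (B + (G * A - A * G))) = clmTrace (A * A * B) := by
    rw [mul_add, mul_sub, clmTrace_add, clmTrace_sub, ← mul_assoc, ← mul_assoc,
      clmTrace_mul_comm (A * A * G) A, ← mul_assoc, ← mul_assoc]; ring
  unfold newtonTransformation₃Deriv newtonTransformation₃
  rw [h1, h2, h3]
  simp only [mul_add, add_mul, mul_sub, sub_mul, smul_add, smul_sub, mul_smul_comm, smul_mul_assoc,
    mul_one, one_mul, ← mul_assoc]
  abel

lemma hasFDerivAt_newtonTransformation₃ [FiniteDimensional ℝ V] {W : Type*}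
    [NormedAddCommGroup W] [NormedSpace ℝ W]
    {A : W → V →L[ℝ] V} {A' : W →L[ℝ] V →L[ℝ] V} {p : W} (hA : HasFDerivAt A A' p) (u : W) :
    DifferentiableAt ℝ (fun q ↦ newtonTransformation₃ (A q)) p ∧
    fderiv ℝ (fun q ↦ newtonTransformation₃ (A q)) p u
      = newtonTransformation₃Deriv (A p) (A' u) := by
  have hAA := hA.mul' hA
  have hAAA := hAA.mul' hA
  have h1 : HasFDerivAt (fun q ↦ clmTrace (A q)) (clmTraceL ∘L A') p :=
    (clmTraceL (V := V)).hasFDerivAt.comp p hA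
  have h2 := (clmTraceL (V := V)).hasFDerivAt.comp p hAA
  have h3 := (clmTraceL (V := V)).hasFDerivAt.comp p hAAA
  have hσ₂ : HasFDerivAt (fun q ↦ newtonSigma₂ (A q)) _ p :=
    (((h1.pow 2).sub h2).const_mul (1 / 2 : ℝ))
  have hσ₃ : HasFDerivAt (fun q ↦ newtonSigma₃ (A q)) _ p :=
    (((h1.pow 3).const_mul (1 / 6 : ℝ)).add (h3.const_mul (1 / 3 : ℝ))).sub
    ((h1.const_mul (1 / 2 : ℝ)).mul h2)
  have key : HasFDerivAt (fun q ↦ newtonTransformation₃ (A q)) _ p :=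
    (((hσ₃.smul_const (1 : V →L[ℝ] V)).sub (hσ₂.smul hA)).add (h1.smul hAA)).sub hAAA
  refine ⟨key.differentiableAt, ?_⟩
  rw [key.fderiv]
  have t1 : clmTrace (A p * A' u) = clmTrace (A' u * A p) := clmTrace_mul_comm _ _
  have t2 : clmTrace (A p * A' u * A p) = clmTrace (A p * A p * A' u) := by
    rw [clmTrace_mul_comm, mul_assoc]
  have t3 : clmTrace (A' u * A p * A p) = clmTrace (A p * A p * A' u) := by
    rw [mul_assoc, clmTrace_mul_comm]
  simp only [newtonTransformation₃Deriv, newtonSigma₂, add_apply, sub_apply, smul_apply,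
    ContinuousLinearMap.comp_apply, ContinuousLinearMap.smulRight_apply,
    MulOpposite.smul_eq_mul_unop, MulOpposite.unop_op, smul_eq_mul, Pi.mul_apply,
    clmTraceL_apply, clmTrace_add, t1, t2, t3, add_mul, mul_add]
  module

/-- For a Codazzi family, the trace of the derivatives of the third Newton transformation
vanishes. -/
lemma sum_newtonTransformation₃Deriv_eq_zero {ι : Type*} [Fintype ι] [DecidableEq ι]
    (b : Module.Basis ι ℝ V)
    (g : V →L[ℝ] V →L[ℝ] ℝ)  (hb : ∀ i j, g (b i) (b j) = if i = j then 1 else 0)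
    (A : V →L[ℝ] V) (B : V → V →L[ℝ] V)
    (hB : ∀ w u v, g (B w u) v = g u (B w v)) (hcod : ∀ u v, B u v = B v u) :
    ∑ i, newtonTransformation₃Deriv A (B (b i)) (b i) = 0 := by
  have hcoord (v : V) (i : ι) : b.repr v i = g v (b i) := by
    have h := congrArg (fun x ↦ g x (b i)) (b.sum_repr v)
    simpa [hb, -Module.Basis.sum_repr] using h
  have hrepr (v : V) : ∑ i, g v (b i) • b i = v := by
    simpa only [hcoord] using b.sum_repr v
  have htr (T : V →L[ℝ] V) : clmTrace T = ∑ i, g (T (b i)) (b i) := by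
    rw [clmTrace, LinearMap.trace_eq_matrix_trace ℝ b, Matrix.trace]
    refine Finset.sum_congr rfl fun i _ ↦ ?_
    simp [LinearMap.toMatrix_apply, hcoord]
  have hgrad (P : V →L[ℝ] V) :
      ∑ i, clmTrace (P * B (b i)) • b i = ∑ i, B (b i) (P (b i)) := by
    rw [← hrepr (∑ i, B (b i) (P (b i)))]
    refine Finset.sum_congr rfl fun j _ ↦ ?_
    congr 1
    rw [clmTrace_mul_comm, htr, map_sum, sum_apply]
    refine Finset.sum_congr rfl fun i _ ↦ ?_
    rw [mul_apply_eq_comp, hB, hcod, ← hB]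
  have hgrad1 : ∑ i, clmTrace (B (b i)) • b i = ∑ i, B (b i) (b i) := by
    simpa using hgrad 1
  have hgrad2 := hgrad A
  have hgrad3 := hgrad (A * A)
  have e1 (T : V →L[ℝ] V) : ∑ i, clmTrace (B (b i)) • T (b i) = T (∑ i, B (b i) (b i)) := by
    rw [← hgrad1]; simp
  have e2 (T : V →L[ℝ] V) :
      ∑ i, clmTrace (A * B (b i)) • T (b i) = T (∑ i, B (b i) (A (b i))) := by
    rw [← hgrad2]; simp
  have expand (i : ι) : newtonTransformation₃Deriv A (B (b i)) (b i)
      = newtonSigma₂ A • (clmTrace (B (b i)) • b i) - clmTrace A • (clmTrace (A * B (b i)) • b i)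
        + clmTrace (A * A * B (b i)) • b i - clmTrace A • (clmTrace (B (b i)) • A (b i))
        + clmTrace (A * B (b i)) • A (b i) - newtonSigma₂ A • B (b i) (b i)
        + clmTrace (B (b i)) • (A * A) (b i) + clmTrace A • B (b i) (A (b i))
        + clmTrace A • A (B (b i) (b i)) - B (b i) ((A * A) (b i)) - A (B (b i) (A (b i)))
        - A (A (B (b i) (b i))) := by
    simp only [newtonTransformation₃Deriv, add_apply,
      sub_apply, smul_apply, mul_apply_eq_comp,
      one_apply_eq_self]
    module
  simp only [expand, Finset.sum_add_distrib, Finset.sum_sub_distrib, ← Finset.smul_sum, ← map_sum,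
    e1, e2, hgrad1, hgrad2, hgrad3]
  simp only [mul_apply_eq_comp]
  module

end NewtonTransformation

section AlgebraicCurvature

/-- A tensor with the symmetries of a curvature tensor whose sectional curvatures vanish is zero. -/
lemma curvatureTensor_eq_zero {V : Type*} [AddCommGroup V] (S : V → V → V → V → ℝ)
    (hadd₁ : ∀ u u' v w z, S (u + u') v w z = S u v w z + S u' v w z)
    (hadd₃ : ∀ u v w w' z, S u v (w + w') z = S u v w z + S u v w' z)
    (hanti₁ : ∀ u v w z, S u v w z = -S v u w z)
    (hanti₂ : ∀ u v w z, S u v w z = -S u v z w)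
    (hbianchi : ∀ u v w z, S u v w z + S v w u z + S w u v z = 0)
    (hsec : ∀ u v, S u v v u = 0) (u v w z : V) : S u v w z = 0 := by
  have hpair (u v w z : V) : S u v w z = S w z u v := by
    have h1 := hbianchi u v w z
    have h2 := hbianchi v w z u
    have h3 := hbianchi w z u v
    have h4 := hbianchi z u v w
    linarith [hanti₂ u v w z, hanti₂ v w u z, hanti₂ w u v z, hanti₂ v w z u, hanti₂ w z v u,
      hanti₂ z v w u, hanti₂ w z u v, hanti₂ z u w v, hanti₂ u w z v, hanti₂ z u v w,
      hanti₂ u v z w, hanti₂ v z u w, hanti₁ u v w z, hanti₁ w u v z, hanti₁ z v w u,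
      hanti₁ u w z v, hanti₁ v z u w, hanti₁ w z u v, hanti₁ v w z u, hanti₁ z u v w]
  have hmid (u v z : V) : S u v v z = 0 := by
    have h := hsec (u + z) v
    rw [hadd₁, hanti₂ u, hanti₂ z, hadd₃, hadd₃, hanti₂ u v u, hanti₂ u v z, hanti₂ z v u,
      hanti₂ z v z, hsec, hsec] at h
    have h2 : S z v v u = S u v v z := by
      rw [hpair, hanti₁, ← hanti₂]
    linarith
  have hadd₂ (u v v' w z : V) : S u (v + v') w z = S u v w z + S u v' w z := by
    rw [hanti₁, hadd₁, hanti₁ u v, hanti₁ u v']; ring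
  have hswap (u v w z : V) : S u v w z = -S u w v z := by
    have h := hmid u (v + w) z
    rw [hadd₂, hadd₃, hadd₃, hmid, hmid] at h
    linarith
  have h := hbianchi u v w z
  have a : S v w u z = S u v w z := by rw [hswap, ← hanti₁]
  have b : S w u v z = S u v w z := by rw [hanti₁, ← hswap]
  linarith

end AlgebraicCurvature

section Coordinates

variable {E : Type*} [NormedAddCommGroup E] [NormedSpace ℝ E]
  {F : Type*} [NormedAddCommGroup F] [NormedSpace ℝ F]

/-- `g` is a smooth Riemannian metric on the open set `U` of a vector space. -/
structure IsMetricOn (g : E → E →L[ℝ] E →L[ℝ] ℝ) (U : Set E) : Prop where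
  isOpen : IsOpen U
  contDiffAt : ∀ p ∈ U, ContDiffAt ℝ ∞ g p
  symm : ∀ p ∈ U, ∀ u v, g p u v = g p v u
  pos : ∀ p ∈ U, ∀ u, u ≠ 0 → 0 < g p u u

/-- The Christoffel symbols of the first kind,
`½ (∂_u g(v, w) + ∂_v g(u, w) - ∂_w g(u, v))`. -/
def christoffelLower (g : E → E →L[ℝ] E →L[ℝ] ℝ) (p : E) : E →L[ℝ] E →L[ℝ] E →L[ℝ] ℝ :=
  (1 / 2 : ℝ) • (fderiv ℝ g p + (fderiv ℝ g p).flip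
    - (ContinuousLinearMap.flipₗᵢ ℝ E E ℝ).toContinuousLinearEquiv.toContinuousLinearMap ∘L
      (fderiv ℝ g p).flip)

lemma christoffelLower_apply (g : E → E →L[ℝ] E →L[ℝ] ℝ) (p u v w : E) :
    christoffelLower g p u v w
      = (1 / 2 : ℝ) * (fderiv ℝ g p u v w + fderiv ℝ g p v u w - fderiv ℝ g p w u v) := by
  simp [christoffelLower]

/-- The Christoffel symbols of the second kind. -/
def christoffel (g : E → E →L[ℝ] E →L[ℝ] ℝ) (p : E) : E →L[ℝ] E →L[ℝ] E :=
  ContinuousLinearMap.compL ℝ E (E →L[ℝ] ℝ) E (g p).inverse ∘L christoffelLower g p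

lemma hasFDerivAt_bilin {G : F → E →L[ℝ] E →L[ℝ] ℝ} {a b : F → E} {p : F}
    {G' : F →L[ℝ] E →L[ℝ] E →L[ℝ] ℝ} {a' b' : F →L[ℝ] E}
    (hG : HasFDerivAt G G' p) (ha : HasFDerivAt a a' p) (hb : HasFDerivAt b b' p) (u : F) :
    fderiv ℝ (fun q ↦ G q (a q) (b q)) p u
      = G' u (a p) (b p) + G p (a' u) (b p) + G p (a p) (b' u) := by
  rw [((hG.clm_apply ha).clm_apply hb).fderiv]
  simp
  ring

namespace IsMetricOn

variable {g : E → E →L[ℝ] E →L[ℝ] ℝ} {U : Set E} (hg : IsMetricOn g U) {p : E} (hp : p ∈ U)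

include hg hp

lemma hasFDerivAt : HasFDerivAt g (fderiv ℝ g p) p :=
  ((hg.contDiffAt p hp).differentiableAt (by simp)).hasFDerivAt

lemma eq_of_forall {u v : E} (h : ∀ w, g p u w = g p v w) : u = v := by
  by_contra hne
  have := hg.pos p hp (u - v) (sub_ne_zero.2 hne)
  simp [map_sub, h] at this

lemma isInvertible [FiniteDimensional ℝ E] : (g p).IsInvertible := by
  have hinj : Function.Injective (g p : E →ₗ[ℝ] E →L[ℝ] ℝ) := fun u v huv ↦
    hg.eq_of_forall hp fun w ↦ by
      have : g p u = g p v := huv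
      rw [this]
  have hdim : Module.finrank ℝ E = Module.finrank ℝ (E →L[ℝ] ℝ) := by
    rw [← LinearEquiv.finrank_eq (LinearMap.toContinuousLinearMap (𝕜 := ℝ) (E := E) (F' := ℝ)),
      Module.finrank_linearMap, Module.finrank_self, mul_one]
  exact ⟨(LinearEquiv.ofInjectiveOfFinrankEq (g p : E →ₗ[ℝ] E →L[ℝ] ℝ) hinj
    hdim).toContinuousLinearEquiv, by ext; rfl⟩

lemma apply_inverse [FiniteDimensional ℝ E] (l : E →L[ℝ] ℝ) (w : E) :
    g p ((g p).inverse l) w = l w := by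
  rw [(hg.isInvertible hp).self_apply_inverse]

lemma fderiv_symm (u v w : E) : fderiv ℝ g p u v w = fderiv ℝ g p u w v := by
  have h : ∀ a b : E, fderiv ℝ (fun q ↦ g q a b) p u = fderiv ℝ g p u a b := fun a b ↦ by
    rw [hasFDerivAt_bilin (hg.hasFDerivAt hp) (hasFDerivAt_const a p) (hasFDerivAt_const b p)]
    simp
  rw [← h, ← h]
  congr 1
  refine Filter.EventuallyEq.fderiv_eq ?_
  filter_upwards [hg.isOpen.mem_nhds hp] with q hq using hg.symm q hq v w

lemma christoffel_spec [FiniteDimensional ℝ E] (u v w : E) :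
    g p (christoffel g p u v) w = christoffelLower g p u v w := by
  simp [christoffel, hg.apply_inverse hp]

lemma christoffel_symm [FiniteDimensional ℝ E] (u v : E) :
    christoffel g p u v = christoffel g p v u := by
  refine hg.eq_of_forall hp fun w ↦ ?_
  rw [hg.christoffel_spec hp, hg.christoffel_spec hp, christoffelLower_apply,
    christoffelLower_apply, hg.fderiv_symm hp w]
  ring

/-- The Levi-Civita connection is metric. -/
lemma fderiv_eq [FiniteDimensional ℝ E] (u v w : E) :
    fderiv ℝ g p u v w = g p (christoffel g p u v) w + g p v (christoffel g p u w) := by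
  rw [hg.symm p hp v, hg.christoffel_spec hp, hg.christoffel_spec hp, christoffelLower_apply,
    christoffelLower_apply, hg.fderiv_symm hp u w, hg.fderiv_symm hp w]
  ring

lemma contDiffAt_inverse [FiniteDimensional ℝ E] : ContDiffAt ℝ ∞ (fun q ↦ (g q).inverse) p := by
  obtain ⟨e, he⟩ := hg.isInvertible hp
  have h := contDiffAt_map_inverse (𝕜 := ℝ) (n := ∞) e
  rw [he] at h
  exact h.comp p (hg.contDiffAt p hp)

set_option synthInstance.maxHeartbeats 200000 in
lemma contDiffAt_christoffel [FiniteDimensional ℝ E] : ContDiffAt ℝ ∞ (christoffel g) p := by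
  have hD : ContDiffAt ℝ ∞ (fderiv ℝ g) p := (hg.contDiffAt p hp).fderiv_right (by simp)
  have hflip : ContDiffAt ℝ ∞ (fun q ↦ (fderiv ℝ g q).flip) p :=
    (ContinuousLinearMap.flipₗᵢ ℝ E E (E →L[ℝ] ℝ)).contDiff.contDiffAt.comp p hD
  have hK : ContDiffAt ℝ ∞ (christoffelLower g) p := by
    unfold christoffelLower
    have h := (hD.add hflip).sub ((contDiffAt_const (c := (ContinuousLinearMap.flipₗᵢ ℝ E E
      ℝ).toContinuousLinearEquiv.toContinuousLinearMap)).clm_comp hflip)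
    exact (contDiff_const_smul (1 / 2 : ℝ)).contDiffAt.comp p h
  unfold christoffel
  exact ((ContinuousLinearMap.compL ℝ E (E →L[ℝ] ℝ) E).contDiff.contDiffAt.comp p
    (hg.contDiffAt_inverse hp)).clm_comp hK

end IsMetricOn

/-- The covariant derivative, in the direction `u`, of the vector field `σ` along the map `φ`,
for the connection with Christoffel symbols `Γ`. -/
def covDerivAlong (Γ : F → F →L[ℝ] F →L[ℝ] F) (φ σ : E → F) (p u : E) : F :=
  fderiv ℝ σ p u + Γ (φ p) (fderiv ℝ φ p u) (σ p)

/-- The curvature of the connection with Christoffel symbols `Γ`. -/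
def curvatureCoord (Γ : F → F →L[ℝ] F →L[ℝ] F) (p u v w : F) : F :=
  fderiv ℝ Γ p u v w - fderiv ℝ Γ p v u w + (Γ p u (Γ p v w) - Γ p v (Γ p u w))

section Along

variable {φ σ τ : E → F} {p : E}

lemma hasFDerivAt_fderiv_apply (hφ : ContDiffAt ℝ ∞ φ p) (v : E) :
    HasFDerivAt (fun q ↦ fderiv ℝ φ q v) ((fderiv ℝ (fderiv ℝ φ) p).flip v) p := by
  have h : ContDiffAt ℝ ∞ (fderiv ℝ φ) p := hφ.fderiv_right (by simp)
  have h' := (h.differentiableAt (by simp)).hasFDerivAt.clm_apply (hasFDerivAt_const v p)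
  refine h'.congr_fderiv ?_
  ext u
  simp

lemma fderiv_fderiv_symm (hφ : ContDiffAt ℝ ∞ φ p) (u v : E) :
    fderiv ℝ (fderiv ℝ φ) p u v = fderiv ℝ (fderiv ℝ φ) p v u :=
  (hφ.isSymmSndFDerivAt (by simp; exact WithTop.coe_le_coe.2 le_top)) u v

lemma covDerivAlong_fderiv_symm {Γ : F → F →L[ℝ] F →L[ℝ] F}
    (hΓ : ∀ a b, Γ (φ p) a b = Γ (φ p) b a) (hφ : ContDiffAt ℝ ∞ φ p) (u v : E) :
    covDerivAlong Γ φ (fun q ↦ fderiv ℝ φ q v) p u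
      = covDerivAlong Γ φ (fun q ↦ fderiv ℝ φ q u) p v := by
  simp only [covDerivAlong, (hasFDerivAt_fderiv_apply hφ _).fderiv,
    ContinuousLinearMap.flip_apply, fderiv_fderiv_symm hφ u v, hΓ (fderiv ℝ φ p u)]

/-- Metric compatibility of the induced connection along a map. -/
lemma IsMetricOn.fderiv_along [FiniteDimensional ℝ F] {g : F → F →L[ℝ] F →L[ℝ] ℝ} {U : Set F}
    (hg : IsMetricOn g U) (hp : φ p ∈ U) (hφ : DifferentiableAt ℝ φ p)
    (hσ : DifferentiableAt ℝ σ p) (hτ : DifferentiableAt ℝ τ p) (u : E) :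
    fderiv ℝ (fun q ↦ g (φ q) (σ q) (τ q)) p u
      = g (φ p) (covDerivAlong (christoffel g) φ σ p u) (τ p)
        + g (φ p) (σ p) (covDerivAlong (christoffel g) φ τ p u) := by
  have h := (hg.hasFDerivAt hp).comp p hφ.hasFDerivAt
  have h2 := hasFDerivAt_bilin h hσ.hasFDerivAt hτ.hasFDerivAt u
  simp only [Function.comp_apply, ContinuousLinearMap.comp_apply, hg.fderiv_eq hp] at h2
  rw [h2]
  simp only [covDerivAlong, map_add, add_apply]
  ring

lemma contDiffAt_covDerivAlong {Γ : F → F →L[ℝ] F →L[ℝ] F}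
    (hΓ : ContDiffAt ℝ ∞ Γ (φ p)) (hφ : ContDiffAt ℝ ∞ φ p) (hσ : ContDiffAt ℝ ∞ σ p) (v : E) :
    ContDiffAt ℝ ∞ (fun q ↦ covDerivAlong Γ φ σ q v) p := by
  have h1 : ContDiffAt ℝ ∞ (fderiv ℝ φ) p := hφ.fderiv_right (by simp)
  have h2 : ContDiffAt ℝ ∞ (fderiv ℝ σ) p := hσ.fderiv_right (by simp)
  unfold covDerivAlong
  exact (h2.clm_apply contDiffAt_const).add
    (((hΓ.comp p hφ).clm_apply (h1.clm_apply contDiffAt_const)).clm_apply hσ)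

/-- The curvature of the induced connection along a map. -/
lemma covDerivAlong_comm {Γ : F → F →L[ℝ] F →L[ℝ] F}
    (hΓ : ContDiffAt ℝ ∞ Γ (φ p)) (hφ : ContDiffAt ℝ ∞ φ p) (hσ : ContDiffAt ℝ ∞ σ p) (u v : E) :
    covDerivAlong Γ φ (fun q ↦ covDerivAlong Γ φ σ q v) p u
      - covDerivAlong Γ φ (fun q ↦ covDerivAlong Γ φ σ q u) p v
      = curvatureCoord Γ (φ p) (fderiv ℝ φ p u) (fderiv ℝ φ p v) (σ p) := by
  have key (a b : E) : fderiv ℝ (fun q ↦ covDerivAlong Γ φ σ q b) p a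
      = fderiv ℝ (fderiv ℝ σ) p a b
        + (fderiv ℝ Γ (φ p) (fderiv ℝ φ p a) (fderiv ℝ φ p b) (σ p)
          + Γ (φ p) (fderiv ℝ (fderiv ℝ φ) p a b) (σ p)
          + Γ (φ p) (fderiv ℝ φ p b) (fderiv ℝ σ p a)) := by
    have hφ' := (hφ.differentiableAt (by simp)).hasFDerivAt
    have hσ' := (hσ.differentiableAt (by simp)).hasFDerivAt
    have hΓ' := (hΓ.differentiableAt (by simp)).hasFDerivAt.comp p hφ'
    have h := (hasFDerivAt_fderiv_apply hσ b).add
      ((hΓ'.clm_apply (hasFDerivAt_fderiv_apply hφ b)).clm_apply hσ')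
    have h' : HasFDerivAt (fun q ↦ covDerivAlong Γ φ σ q b) _ p := h
    rw [h'.fderiv]
    simp only [add_apply, ContinuousLinearMap.flip_apply, ContinuousLinearMap.comp_apply,
      Function.comp_apply]
    abel
  unfold covDerivAlong at key ⊢
  rw [key, key]
  simp only [curvatureCoord, map_add, fderiv_fderiv_symm hφ u v, fderiv_fderiv_symm hσ u v]
  abel

end Along

end Coordinates

section ConstantCurvature

variable {F : Type*} [NormedAddCommGroup F] [NormedSpace ℝ F]
  {g : F → F →L[ℝ] F →L[ℝ] ℝ} {U : Set F} {p : F}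

lemma covDerivAlong_id_const (Γ : F → F →L[ℝ] F →L[ℝ] F) (w p u : F) :
    covDerivAlong Γ id (fun _ ↦ w) p u = Γ p u w := by
  simp [covDerivAlong]

variable [FiniteDimensional ℝ F]

namespace IsMetricOn

lemma fderiv_christoffel_symm (hg : IsMetricOn g U) (hp : p ∈ U) (u v w : F) :
    fderiv ℝ (christoffel g) p u v w = fderiv ℝ (christoffel g) p u w v := by
  have hd := ((hg.contDiffAt_christoffel hp).differentiableAt (by simp)).hasFDerivAt
  have h : ∀ a b : F, fderiv ℝ (fun q ↦ christoffel g q a b) p u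
      = fderiv ℝ (christoffel g) p u a b := fun a b ↦ by
    rw [((hd.clm_apply (hasFDerivAt_const a p)).clm_apply (hasFDerivAt_const b p)).fderiv]
    simp
  rw [← h, ← h]
  congr 1
  refine Filter.EventuallyEq.fderiv_eq ?_
  filter_upwards [hg.isOpen.mem_nhds hp] with q hq using hg.christoffel_symm hq v w

lemma curvatureCoord_antisymm (hg : IsMetricOn g U) (hp : p ∈ U) (u v w z : F) :
    g p (curvatureCoord (christoffel g) p u v w) z
      = -g p (curvatureCoord (christoffel g) p u v z) w := by
  have hΓ {q : F} (hq : q ∈ U) := hg.contDiffAt_christoffel hq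
  have hconst (a b : F) {q : F} (hq : q ∈ U) :
      ContDiffAt ℝ ∞ (fun q ↦ covDerivAlong (christoffel g) id (fun _ ↦ a) q b) q :=
    contDiffAt_covDerivAlong (hΓ hq) contDiffAt_id contDiffAt_const b
  have hsmooth : ContDiffAt ℝ ∞ (fun q ↦ g q w z) p :=
    ((hg.contDiffAt p hp).clm_apply contDiffAt_const).clm_apply contDiffAt_const
  have hfirst (b : F) {q : F} (hq : q ∈ U) : fderiv ℝ (fun q ↦ g q w z) q b
      = g q (covDerivAlong (christoffel g) id (fun _ ↦ w) q b) z
        + g q w (covDerivAlong (christoffel g) id (fun _ ↦ z) q b) :=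
    hg.fderiv_along (φ := id) (σ := fun _ ↦ w) (τ := fun _ ↦ z) hq differentiableAt_id
      (differentiableAt_const _) (differentiableAt_const _) b
  have hsecond (a b : F) : fderiv ℝ (fderiv ℝ (fun q ↦ g q w z)) p a b
      = g p (covDerivAlong (christoffel g) id
            (fun q ↦ covDerivAlong (christoffel g) id (fun _ ↦ w) q b) p a) z
        + g p (christoffel g p b w) (christoffel g p a z)
        + (g p (christoffel g p a w) (christoffel g p b z)
        + g p w (covDerivAlong (christoffel g) id
            (fun q ↦ covDerivAlong (christoffel g) id (fun _ ↦ z) q b) p a)) := by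
    have h1 := (hasFDerivAt_fderiv_apply hsmooth b).fderiv
    have h2 : fderiv ℝ (fun q ↦ fderiv ℝ (fun q ↦ g q w z) q b) p
        = fderiv ℝ (fun q ↦ g q (covDerivAlong (christoffel g) id (fun _ ↦ w) q b) z
        + g q w (covDerivAlong (christoffel g) id (fun _ ↦ z) q b)) p := by
      refine Filter.EventuallyEq.fderiv_eq ?_
      filter_upwards [hg.isOpen.mem_nhds hp] with q hq using hfirst b hq
    have d1 := (hconst w b hp).differentiableAt (by simp)
    have d2 := (hconst z b hp).differentiableAt (by simp)
    have dg := (hg.hasFDerivAt hp).differentiableAt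
    have e1 := hg.fderiv_along (φ := id) (τ := fun _ ↦ z) hp differentiableAt_id d1
      (differentiableAt_const _) a
    have e2 := hg.fderiv_along (φ := id) (σ := fun _ ↦ w) hp differentiableAt_id
      (differentiableAt_const _) d2 a
    have h3 : fderiv ℝ (fderiv ℝ (fun q ↦ g q w z)) p a b
        = fderiv ℝ (fun q ↦ fderiv ℝ (fun q ↦ g q w z) q b) p a := by
      rw [h1]; rfl
    rw [h3, h2, fderiv_fun_add ((dg.clm_apply d1).clm_apply (differentiableAt_const _))
      ((dg.clm_apply (differentiableAt_const _)).clm_apply d2), add_apply]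
    simp only [covDerivAlong_id_const, id] at e1 e2 ⊢
    rw [e1, e2]
  have hcomm := fderiv_fderiv_symm hsmooth u v
  rw [hsecond, hsecond] at hcomm
  have cw := covDerivAlong_comm (σ := fun _ ↦ w) (hΓ hp) contDiffAt_id contDiffAt_const u v
  have cz := covDerivAlong_comm (σ := fun _ ↦ z) (hΓ hp) contDiffAt_id contDiffAt_const u v
  simp only [fderiv_id, ContinuousLinearMap.id_apply, id] at cw cz
  rw [← cw, ← cz, hg.symm p hp _ w]
  simp only [map_sub, sub_apply]
  linarith

/-- A metric of constant sectional curvature has the curvature tensor of a space form. -/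
lemma curvatureCoord_of_sectional (hg : IsMetricOn g U) (hp : p ∈ U) (c : ℝ)
    (hc : ∀ u v, LinearIndependent ℝ ![u, v] → g p (curvatureCoord (christoffel g) p u v v) u
      = c * (g p u u * g p v v - g p u v ^ 2)) (u v w z : F) :
    g p (curvatureCoord (christoffel g) p u v w) z
      = c * (g p v w * g p u z - g p u w * g p v z) := by
  have hs := hg.symm p hp
  have hΓ := hg.christoffel_symm hp
  have hanti : ∀ u v w, curvatureCoord (christoffel g) p u v w
      = -curvatureCoord (christoffel g) p v u w := fun u v w ↦ by
    simp only [curvatureCoord]; abel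
  rw [← sub_eq_zero]
  refine curvatureTensor_eq_zero (fun u v w z ↦ g p (curvatureCoord (christoffel g) p u v w) z
      - c * (g p v w * g p u z - g p u w * g p v z)) ?_ ?_ ?_ ?_ ?_ ?_ u v w z
  · intro u u' v w z
    simp only [curvatureCoord, map_add, map_sub, add_apply, sub_apply]
    ring
  · intro u v w w' z
    simp only [curvatureCoord, map_add, map_sub, add_apply, sub_apply]
    ring
  · intro u v w z
    rw [hanti u v]
    simp only [map_neg, neg_apply]
    ring
  · intro u v w z
    rw [hg.curvatureCoord_antisymm hp u v w z]
    ring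
  · intro u v w z
    have : curvatureCoord (christoffel g) p u v w + curvatureCoord (christoffel g) p v w u
        + curvatureCoord (christoffel g) p w u v = 0 := by
      simp only [curvatureCoord, hΓ w u, hΓ w v, hΓ v u, hg.fderiv_christoffel_symm hp u w v,
        hg.fderiv_christoffel_symm hp v w u, hg.fderiv_christoffel_symm hp w v u]
      abel
    have h2 := congrArg (fun a ↦ g p a z) this
    simp only [map_add, add_apply, map_zero, zero_apply] at h2
    rw [hs w u, hs w v, hs v u]
    linear_combination h2
  · intro u v
    by_cases hli : LinearIndependent ℝ ![u, v]
    · rw [hc u v hli, hs v u]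
      ring
    · rcases eq_or_ne u 0 with rfl | hu
      · simp
      · rw [LinearIndependent.pair_iff' hu] at hli
        push Not at hli
        obtain ⟨a, rfl⟩ := hli
        simp only [curvatureCoord, map_smul, smul_apply, sub_self, smul_eq_mul, map_zero,
          zero_apply, add_zero]
        ring

end IsMetricOn

end ConstantCurvature

section HypersurfaceCoordinates

variable {E : Type*} [NormedAddCommGroup E] [NormedSpace ℝ E]
  {F : Type*} [NormedAddCommGroup F] [NormedSpace ℝ F]

/-- `φ` is an isometric immersion, with unit normal field `η`, of the open set `U` with the metric
`g` as a hypersurface of the open set `U'` with the metric `g'`. -/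
structure IsHypersurfaceOn (g : E → E →L[ℝ] E →L[ℝ] ℝ) (g' : F → F →L[ℝ] F →L[ℝ] ℝ)
    (φ η : E → F) (U : Set E) (U' : Set F) : Prop where
  metric : IsMetricOn g U
  metric' : IsMetricOn g' U'
  mapsTo : ∀ p ∈ U, φ p ∈ U'
  contDiffAt : ∀ p ∈ U, ContDiffAt ℝ ∞ φ p
  contDiffAt_normal : ∀ p ∈ U, ContDiffAt ℝ ∞ η p
  isometry : ∀ p ∈ U, ∀ u v, g' (φ p) (fderiv ℝ φ p u) (fderiv ℝ φ p v) = g p u v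
  unit : ∀ p ∈ U, g' (φ p) (η p) (η p) = 1
  normal : ∀ p ∈ U, ∀ v, g' (φ p) (η p) (fderiv ℝ φ p v) = 0
  finrank_eq : Module.finrank ℝ F = Module.finrank ℝ E + 1

/-- The second fundamental form `-⟨∇_v η, dφ w⟩`. -/
def secondForm (g' : F → F →L[ℝ] F →L[ℝ] ℝ) (φ η : E → F) (p v w : E) : ℝ :=
  -g' (φ p) (covDerivAlong (christoffel g') φ η p v) (fderiv ℝ φ p w)

namespace IsHypersurfaceOn

variable {g : E → E →L[ℝ] E →L[ℝ] ℝ} {g' : F → F →L[ℝ] F →L[ℝ] ℝ}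
  {φ η : E → F} {U : Set E} {U' : Set F} (hyp : IsHypersurfaceOn g g' φ η U U')
  {p : E} (hp : p ∈ U)

include hyp hp

lemma differentiableAt : DifferentiableAt ℝ φ p :=
  (hyp.contDiffAt p hp).differentiableAt (by simp)

lemma differentiableAt_normal : DifferentiableAt ℝ η p :=
  (hyp.contDiffAt_normal p hp).differentiableAt (by simp)

lemma contDiffAt_fderiv_apply (v : E) : ContDiffAt ℝ ∞ (fun q ↦ fderiv ℝ φ q v) p := by
  have h : ContDiffAt ℝ ∞ (fderiv ℝ φ) p := (hyp.contDiffAt p hp).fderiv_right (by simp)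
  exact h.clm_apply contDiffAt_const

lemma differentiableAt_fderiv_apply (v : E) : DifferentiableAt ℝ (fun q ↦ fderiv ℝ φ q v) p :=
  (hyp.contDiffAt_fderiv_apply hp v).differentiableAt (by simp)

variable [FiniteDimensional ℝ F]

lemma covDerivAlong_symm (u v : E) :
    covDerivAlong (christoffel g') φ (fun q ↦ fderiv ℝ φ q v) p u
      = covDerivAlong (christoffel g') φ (fun q ↦ fderiv ℝ φ q u) p v :=
  covDerivAlong_fderiv_symm (hyp.metric'.christoffel_symm (hyp.mapsTo p hp))
    (hyp.contDiffAt p hp) u v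

lemma inner_covDerivAlong_normal (u : E) :
    g' (φ p) (covDerivAlong (christoffel g') φ η p u) (η p) = 0 := by
  have h := hyp.metric'.fderiv_along (hyp.mapsTo p hp) (hyp.differentiableAt hp)
    (hyp.differentiableAt_normal hp) (hyp.differentiableAt_normal hp) u
  have h0 : fderiv ℝ (fun q ↦ g' (φ q) (η q) (η q)) p = 0 := by
    rw [Filter.EventuallyEq.fderiv_eq (f := fun _ ↦ (1 : ℝ))]
    · simp
    · filter_upwards [hyp.metric.isOpen.mem_nhds hp] with q hq using hyp.unit q hq
  rw [h0, hyp.metric'.symm _ (hyp.mapsTo p hp) (η p)] at h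
  simp only [zero_apply] at h
  linarith

lemma secondForm_eq (u w : E) : secondForm g' φ η p u w
    = g' (φ p) (η p) (covDerivAlong (christoffel g') φ (fun q ↦ fderiv ℝ φ q w) p u) := by
  have h := hyp.metric'.fderiv_along (hyp.mapsTo p hp) (hyp.differentiableAt hp)
    (hyp.differentiableAt_normal hp) (hyp.differentiableAt_fderiv_apply hp w) u
  have h0 : fderiv ℝ (fun q ↦ g' (φ q) (η q) (fderiv ℝ φ q w)) p = 0 := by
    rw [Filter.EventuallyEq.fderiv_eq (f := fun _ ↦ (0 : ℝ))]
    · simp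
    · filter_upwards [hyp.metric.isOpen.mem_nhds hp] with q hq using hyp.normal q hq w
  rw [h0] at h
  simp only [zero_apply] at h
  unfold secondForm
  linarith

lemma secondForm_symm (u w : E) : secondForm g' φ η p u w = secondForm g' φ η p w u := by
  rw [hyp.secondForm_eq hp, hyp.secondForm_eq hp, hyp.covDerivAlong_symm hp]

variable [FiniteDimensional ℝ E]

/-- The tangential part of the Gauss formula. -/
lemma christoffel_eq (u v w : E) : g p (christoffel g p u v) w
    = g' (φ p) (covDerivAlong (christoffel g') φ (fun q ↦ fderiv ℝ φ q v) p u)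
      (fderiv ℝ φ p w) := by
  have key (a b c : E) : fderiv ℝ g p a b c
      = g' (φ p) (covDerivAlong (christoffel g') φ (fun q ↦ fderiv ℝ φ q b) p a) (fderiv ℝ φ p c)
        + g' (φ p) (covDerivAlong (christoffel g') φ (fun q ↦ fderiv ℝ φ q c) p a)
          (fderiv ℝ φ p b) := by
    have h := hyp.metric'.fderiv_along (hyp.mapsTo p hp) (hyp.differentiableAt hp)
      (hyp.differentiableAt_fderiv_apply hp b) (hyp.differentiableAt_fderiv_apply hp c) a
    rw [hyp.metric'.symm _ (hyp.mapsTo p hp) (fderiv ℝ φ p b)] at h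
    rw [← h]
    have h0 : fderiv ℝ (fun q ↦ g' (φ q) (fderiv ℝ φ q b) (fderiv ℝ φ q c)) p
        = fderiv ℝ (fun q ↦ g q b c) p := by
      refine Filter.EventuallyEq.fderiv_eq ?_
      filter_upwards [hyp.metric.isOpen.mem_nhds hp] with q hq using hyp.isometry q hq b c
    rw [h0, hasFDerivAt_bilin (hyp.metric.hasFDerivAt hp) (hasFDerivAt_const b p)
      (hasFDerivAt_const c p)]
    simp
  rw [hyp.metric.christoffel_spec hp, christoffelLower_apply, key, key, key,
    hyp.covDerivAlong_symm hp u v, hyp.covDerivAlong_symm hp u w, hyp.covDerivAlong_symm hp v w]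
  ring

/-- Vectors orthogonal to the hypersurface are orthogonal to vectors orthogonal to the normal. -/
lemma inner_eq_zero {a b : F} (ha : g' (φ p) a (η p) = 0)
    (hb : ∀ v, g' (φ p) b (fderiv ℝ φ p v) = 0) : g' (φ p) a b = 0 := by
  let T : E × ℝ →ₗ[ℝ] F := LinearMap.coprod (fderiv ℝ φ p : E →ₗ[ℝ] F)
    (LinearMap.toSpanSingleton ℝ F (η p))
  have hT (x : E × ℝ) : T x = fderiv ℝ φ p x.1 + x.2 • η p := rfl
  have hzero {v : E} (hv : g p v v = 0) : v = 0 := by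
    by_contra hne
    exact (hyp.metric.pos p hp v hne).ne' hv
  have hinj : Function.Injective T := by
    rw [injective_iff_map_eq_zero]
    rintro ⟨v, t⟩ hvt
    rw [hT] at hvt
    have h1 := congrArg (fun y ↦ g' (φ p) (η p) y) hvt
    simp only [map_add, map_smul, hyp.normal p hp, hyp.unit p hp, map_zero, smul_eq_mul, mul_one,
      zero_add] at h1
    subst h1
    have h2 := congrArg (fun y ↦ g' (φ p) (fderiv ℝ φ p v) y) hvt
    simp only [zero_smul, add_zero, hyp.isometry p hp, map_zero] at h2
    rw [hzero h2]
    rfl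
  have hsurj : Function.Surjective T := by
    refine (LinearMap.injective_iff_surjective_of_finrank_eq_finrank ?_).1 hinj
    rw [Module.finrank_prod, Module.finrank_self, hyp.finrank_eq]
  obtain ⟨⟨v, t⟩, rfl⟩ := hsurj b
  rw [hT] at hb ⊢
  have hv := hb v
  simp only [map_add, map_smul, add_apply, smul_apply, hyp.normal p hp, hyp.isometry p hp,
    smul_zero, add_zero] at hv
  rw [hzero hv]
  simp [ha]

lemma inner_covDerivAlong_normal_covDerivAlong (u v w : E) :
    g' (φ p) (covDerivAlong (christoffel g') φ η p v)
      (covDerivAlong (christoffel g') φ (fun q ↦ fderiv ℝ φ q w) p u)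
      = -secondForm g' φ η p v (christoffel g p u w) := by
  have h := hyp.inner_eq_zero hp (hyp.inner_covDerivAlong_normal hp v)
    (b := covDerivAlong (christoffel g') φ (fun q ↦ fderiv ℝ φ q w) p u
      - fderiv ℝ φ p (christoffel g p u w)) (fun z ↦ by
      rw [map_sub, sub_apply, ← hyp.christoffel_eq hp, hyp.isometry p hp, sub_self])
  rw [map_sub, sub_eq_zero] at h
  rw [h, secondForm, neg_neg]

/-- The Codazzi equation for hypersurfaces of a space form. -/
lemma codazzi {c : ℝ} (hc : ∀ a b d e, g' (φ p) (curvatureCoord (christoffel g') (φ p) a b d) e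
      = c * (g' (φ p) b d * g' (φ p) a e - g' (φ p) a d * g' (φ p) b e)) (u v w : E) :
    fderiv ℝ (fun q ↦ secondForm g' φ η q v w) p u - secondForm g' φ η p v (christoffel g p u w)
      = fderiv ℝ (fun q ↦ secondForm g' φ η q u w) p v
        - secondForm g' φ η p u (christoffel g p v w) := by
  have hs := hyp.metric'.symm _ (hyp.mapsTo p hp)
  have hΓ := hyp.metric'.contDiffAt_christoffel (hyp.mapsTo p hp)
  have hD (a b : E) : fderiv ℝ (fun q ↦ secondForm g' φ η q b w) p a
      = -g' (φ p) (covDerivAlong (christoffel g') φ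
            (fun q ↦ covDerivAlong (christoffel g') φ η q b) p a) (fderiv ℝ φ p w)
        + secondForm g' φ η p b (christoffel g p a w) := by
    have hd := contDiffAt_covDerivAlong hΓ (hyp.contDiffAt p hp) (hyp.contDiffAt_normal p hp) b
    have h := hyp.metric'.fderiv_along (hyp.mapsTo p hp) (hyp.differentiableAt hp)
      (hd.differentiableAt (by simp)) (hyp.differentiableAt_fderiv_apply hp w) a
    rw [hyp.inner_covDerivAlong_normal_covDerivAlong hp] at h
    unfold secondForm at h ⊢
    rw [fderiv_fun_neg, neg_apply, h]
    ring
  have hcomm := covDerivAlong_comm hΓ (hyp.contDiffAt p hp) (hyp.contDiffAt_normal p hp) u v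
  have hR := hc (fderiv ℝ φ p u) (fderiv ℝ φ p v) (η p) (fderiv ℝ φ p w)
  rw [hs _ (η p), hs _ (η p), hyp.normal p hp, hyp.normal p hp, ← hcomm, map_sub, sub_apply] at hR
  rw [hD, hD]
  linarith

omit hp in
lemma contDiffOn_shape {A : E → E →L[ℝ] E}
    (hA : ∀ q ∈ U, ∀ v w, g q (A q v) w = secondForm g' φ η q v w) : ContDiffOn ℝ ∞ A U := by
  rw [contDiffOn_clm_apply]
  intro v q hq
  have heq : ∀ r ∈ U, A r v = (g r).inverse
      (-(g' (φ r) (covDerivAlong (christoffel g') φ η r v) ∘L fderiv ℝ φ r)) := fun r hr ↦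
    hyp.metric.eq_of_forall hr fun w ↦ by
      rw [hA r hr, hyp.metric.apply_inverse hr]
      rfl
  have hd := contDiffAt_covDerivAlong (hyp.metric'.contDiffAt_christoffel (hyp.mapsTo q hq))
    (hyp.contDiffAt q hq) (hyp.contDiffAt_normal q hq) v
  have hφ : ContDiffAt ℝ ∞ (fderiv ℝ φ) q := (hyp.contDiffAt q hq).fderiv_right (by simp)
  have hg' := (hyp.metric'.contDiffAt _ (hyp.mapsTo q hq)).comp q (hyp.contDiffAt q hq)
  have := (hyp.metric.contDiffAt_inverse hq).clm_apply ((hg'.clm_apply hd).clm_comp hφ).neg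
  exact this.contDiffWithinAt.congr heq (heq q hq)

/-- The third Newton transformation of the shape operator is divergence-free, in coordinates. -/
lemma divergence_newtonTransformation₃_eq_zero {c : ℝ}
    (hc : ∀ a b d e, g' (φ p) (curvatureCoord (christoffel g') (φ p) a b d) e
      = c * (g' (φ p) b d * g' (φ p) a e - g' (φ p) a d * g' (φ p) b e))
    {A : E → E →L[ℝ] E} (hA : ∀ q ∈ U, ∀ v w, g q (A q v) w = secondForm g' φ η q v w)
    {ι : Type*} [Fintype ι] [DecidableEq ι] (b : Module.Basis ι ℝ E)
    (hb : ∀ i j, g p (b i) (b j) = if i = j then 1 else 0) :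
    ∑ i, (fderiv ℝ (fun q ↦ newtonTransformation₃ (A q)) p (b i) (b i)
      + christoffel g p (b i) (newtonTransformation₃ (A p) (b i))
      - newtonTransformation₃ (A p) (christoffel g p (b i) (b i))) = 0 := by
  have hAd : HasFDerivAt A (fderiv ℝ A p) p :=
    (((hyp.contDiffOn_shape hA).contDiffAt (hyp.metric.isOpen.mem_nhds hp)).differentiableAt
      (by simp)).hasFDerivAt
  let B : E → E →L[ℝ] E := fun u ↦
    fderiv ℝ A p u + (christoffel g p u * A p - A p * christoffel g p u)
  have hBapply (u v w : E) : g p (B u v) w = fderiv ℝ (fun q ↦ secondForm g' φ η q v w) p u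
      - secondForm g' φ η p v (christoffel g p u w)
      - secondForm g' φ η p (christoffel g p u v) w := by
    have h0 : fderiv ℝ (fun q ↦ secondForm g' φ η q v w) p
        = fderiv ℝ (fun q ↦ g q (A q v) w) p := by
      refine Filter.EventuallyEq.fderiv_eq ?_
      filter_upwards [hyp.metric.isOpen.mem_nhds hp] with q hq using (hA q hq v w).symm
    rw [h0, hasFDerivAt_bilin (hyp.metric.hasFDerivAt hp)
      (hAd.clm_apply (hasFDerivAt_const v p)) (hasFDerivAt_const w p), hyp.metric.fderiv_eq hp,
      ← hA p hp, ← hA p hp]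
    simp [B]
    ring
  have hsymm (w u v : E) : g p (B w u) v = g p u (B w v) := by
    have h0 : fderiv ℝ (fun q ↦ secondForm g' φ η q u v) p
        = fderiv ℝ (fun q ↦ secondForm g' φ η q v u) p := by
      refine Filter.EventuallyEq.fderiv_eq ?_
      filter_upwards [hyp.metric.isOpen.mem_nhds hp] with q hq using hyp.secondForm_symm hq u v
    rw [hyp.metric.symm p hp u, hBapply, hBapply, h0, hyp.secondForm_symm hp u,
      hyp.secondForm_symm hp v]
    ring
  have hcod (u v : E) : B u v = B v u := by
    refine hyp.metric.eq_of_forall hp fun w ↦ ?_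
    rw [hBapply, hBapply, hyp.codazzi hp hc, hyp.metric.christoffel_symm hp u v]
  rw [← sum_newtonTransformation₃Deriv_eq_zero b (g p) hb (A p) B hsymm hcod]
  refine Finset.sum_congr rfl fun i _ ↦ ?_
  rw [newtonTransformation₃Deriv_add_commutator, (hasFDerivAt_newtonTransformation₃ hAd _).2]
  simp only [add_apply, sub_apply, mul_apply_eq_comp]
  abel

end IsHypersurfaceOn

end HypersurfaceCoordinates

section ChartCoordinates

variable {E : Type*} [NormedAddCommGroup E] [NormedSpace ℝ E]
  {H : Type*} [TopologicalSpace H] (I : ModelWithCorners ℝ E H)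
  {M : Type*} [TopologicalSpace M] [ChartedSpace H M] [IsManifold I ∞ M]

/-- The components of tangent vectors at `y` in the chart at `x₀`. -/
def coordMap (x₀ y : M) : TangentSpace I y →L[ℝ] E :=
  (trivializationAt E (TangentSpace I) x₀).continuousLinearMapAt ℝ y

/-- The tangent vector at `y` with given components in the chart at `x₀`. -/
def coordSymm (x₀ y : M) : E →L[ℝ] TangentSpace I y :=
  (trivializationAt E (TangentSpace I) x₀).symmL ℝ y

variable {I} {x₀ y : M}

lemma coordMap_coordSymm (hy : y ∈ (extChartAt I x₀).source) (v : E) :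
    coordMap I x₀ y (coordSymm I x₀ y v) = v :=
  (trivializationAt E (TangentSpace I) x₀).continuousLinearMapAt_symmL (R := ℝ)
    (by simpa using hy) v

lemma coordSymm_coordMap (hy : y ∈ (extChartAt I x₀).source) (v : TangentSpace I y) :
    coordSymm I x₀ y (coordMap I x₀ y v) = v :=
  (trivializationAt E (TangentSpace I) x₀).symmL_continuousLinearMapAt (R := ℝ)
    (by simpa using hy) v

lemma trivializationAt_eq_coordMap (hy : y ∈ (extChartAt I x₀).source) (v : TangentSpace I y) :
    (trivializationAt E (TangentSpace I) x₀ ⟨y, v⟩).2 = coordMap I x₀ y v := by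
  have h : y ∈ (trivializationAt E (TangentSpace I : M → Type _) x₀).baseSet := by simpa using hy
  simp only [coordMap, Trivialization.continuousLinearMapAt_apply]
  rw [Trivialization.coe_linearMapAt_of_mem _ h]

lemma coordMap_eq_mfderiv (hy : y ∈ (extChartAt I x₀).source) :
    coordMap I x₀ y = mfderiv I 𝓘(ℝ, E) (extChartAt I x₀) y :=
  TangentBundle.continuousLinearMapAt_trivializationAt (by simpa using hy)

variable [I.Boundaryless]

lemma contMDiffAt_extChartAt_symm' {p : E} (hp : p ∈ (extChartAt I x₀).target) :
    ContMDiffAt 𝓘(ℝ, E) I ∞ (extChartAt I x₀).symm p :=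
  (contMDiffOn_extChartAt_symm x₀).contMDiffAt ((isOpen_extChartAt_target x₀).mem_nhds hp)

lemma coordSymm_eq_mfderiv (hy : y ∈ (extChartAt I x₀).source) :
    coordSymm I x₀ y = mfderiv 𝓘(ℝ, E) I (extChartAt I x₀).symm (extChartAt I x₀ y) := by
  have := TangentBundle.symmL_trivializationAt (I := I) (x₀ := x₀) (x := y) (by simpa using hy)
  rw [I.range_eq_univ, mfderivWithin_univ] at this
  exact this

omit [IsManifold I ∞ M] [I.Boundaryless] in
lemma eventuallyEq_comp_extChartAt_symm {F : Type*} (h : M → F)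
    (hy : y ∈ (extChartAt I x₀).source) :
    h =ᶠ[𝓝 y] (h ∘ (extChartAt I x₀).symm) ∘ extChartAt I x₀ := by
  filter_upwards [extChartAt_source_mem_nhds' hy] with z hz
  rw [Function.comp_apply, Function.comp_apply, (extChartAt I x₀).left_inv hz]

variable {F : Type*} [NormedAddCommGroup F] [NormedSpace ℝ F]

lemma mdifferentiableAt_iff_coord {h : M → F} (hy : y ∈ (extChartAt I x₀).source) :
    MDifferentiableAt I 𝓘(ℝ, F) h y ↔
      DifferentiableAt ℝ (h ∘ (extChartAt I x₀).symm) (extChartAt I x₀ y) := by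
  rw [← mdifferentiableAt_iff_differentiableAt]
  constructor
  · intro hh
    refine MDifferentiableAt.comp (I' := I) _ ?_
      ((contMDiffAt_extChartAt_symm' ((extChartAt I x₀).map_source hy)).mdifferentiableAt (by simp))
    rwa [(extChartAt I x₀).left_inv hy]
  · intro hh
    refine MDifferentiableAt.congr_of_eventuallyEq ?_ (eventuallyEq_comp_extChartAt_symm h hy)
    exact hh.comp y (mdifferentiableAt_extChartAt (by simpa using hy))

lemma mvfderiv_eq_coord {h : M → F} (hy : y ∈ (extChartAt I x₀).source)
    (hh : MDifferentiableAt I 𝓘(ℝ, F) h y) (v : TangentSpace I y) :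
    mvfderiv I h y v
      = fderiv ℝ (h ∘ (extChartAt I x₀).symm) (extChartAt I x₀ y) (coordMap I x₀ y v) := by
  have hd := ((mdifferentiableAt_iff_coord hy).1 hh).hasFDerivAt.hasMFDerivAt
  have hκ := (mdifferentiableAt_extChartAt (I := I) (x := x₀) (by simpa using hy)).hasMFDerivAt
  have h := (hd.comp y hκ).congr_of_eventuallyEq (eventuallyEq_comp_extChartAt_symm h hy)
  rw [mvfderiv, h.mfderiv, coordMap_eq_mfderiv hy]
  rfl

variable (I) in
/-- The components of a vector field in the chart at `x₀`. -/
def fieldCoord (x₀ : M) (X : Π y : M, TangentSpace I y) (p : E) : E :=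
  coordMap I x₀ ((extChartAt I x₀).symm p) (X ((extChartAt I x₀).symm p))

omit [I.Boundaryless] in
lemma fieldCoord_extChartAt (X : Π y : M, TangentSpace I y) (hy : y ∈ (extChartAt I x₀).source) :
    fieldCoord I x₀ X (extChartAt I x₀ y) = coordMap I x₀ y (X y) := by
  unfold fieldCoord
  rw [(extChartAt I x₀).left_inv hy]

lemma mdifferentiableAt_field_iff (X : Π y : M, TangentSpace I y)
    (hy : y ∈ (extChartAt I x₀).source) :
    MDifferentiableAt I I.tangent (fun z ↦ (⟨z, X z⟩ : TangentBundle I M)) y ↔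
      DifferentiableAt ℝ (fieldCoord I x₀ X) (extChartAt I x₀ y) := by
  have h := (trivializationAt E (TangentSpace I : M → Type _) x₀).mdifferentiableAt_section_iff I X
    (b₀ := y) (by simpa using hy)
  refine h.trans ?_
  rw [mdifferentiableAt_iff_coord hy]
  refine Filter.EventuallyEq.differentiableAt_iff ?_
  filter_upwards [(isOpen_extChartAt_target x₀).mem_nhds ((extChartAt I x₀).map_source hy)]
    with p hp
  exact trivializationAt_eq_coordMap ((extChartAt I x₀).map_target hp) _

lemma coordMap_mlieBracket [CompleteSpace E] {X Y : Π y : M, TangentSpace I y}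
    (hy : y ∈ (extChartAt I x₀).source)
    (hX : MDifferentiableAt I I.tangent (fun z ↦ (⟨z, X z⟩ : TangentBundle I M)) y)
    (hY : MDifferentiableAt I I.tangent (fun z ↦ (⟨z, Y z⟩ : TangentBundle I M)) y) :
    coordMap I x₀ y (VectorField.mlieBracket I X Y y)
      = fderiv ℝ (fieldCoord I x₀ Y) (extChartAt I x₀ y) (coordMap I x₀ y (X y))
        - fderiv ℝ (fieldCoord I x₀ X) (extChartAt I x₀ y) (coordMap I x₀ y (Y y)) := by
  have hinv {z : M} (hz : z ∈ (extChartAt I x₀).source) :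
      (coordSymm I x₀ z).inverse = coordMap I x₀ z :=
    ContinuousLinearMap.inverse_eq (by ext v; exact coordSymm_coordMap hz v)
      (by ext v; exact coordMap_coordSymm hz v)
  have hp := (extChartAt I x₀).map_source hy
  have hpull (Z : Π y : M, TangentSpace I y) {q : E} (hq : q ∈ (extChartAt I x₀).target) :
      VectorField.mpullback 𝓘(ℝ, E) I (extChartAt I x₀).symm Z q = fieldCoord I x₀ Z q := by
    have hz := (extChartAt I x₀).map_target hq
    rw [VectorField.mpullback_apply, fieldCoord, ← hinv hz, coordSymm_eq_mfderiv hz,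
      (extChartAt I x₀).right_inv hq]
    rfl
  have heq := (extChartAt I x₀).left_inv hy
  have hev (Z : Π y : M, TangentSpace I y) :
      VectorField.mpullback 𝓘(ℝ, E) I (extChartAt I x₀).symm Z
        =ᶠ[𝓝 (extChartAt I x₀ y)] fieldCoord I x₀ Z := by
    filter_upwards [(isOpen_extChartAt_target x₀).mem_nhds hp] with q hq using hpull Z hq
  have hle : minSmoothness ℝ 2 ≤ (∞ : WithTop ℕ∞) := by
    simp only [minSmoothness_of_isRCLikeNormedField]
    exact WithTop.coe_le_coe.2 le_top
  have : IsManifold I (minSmoothness ℝ 2) M := IsManifold.of_le hle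
  have hlie (V W : Π x : E, TangentSpace 𝓘(ℝ, E) x) :
      VectorField.mlieBracket 𝓘(ℝ, E) V W = VectorField.lieBracket ℝ (E := E) V W :=
    (VectorField.mlieBracketWithin_eq_lieBracketWithin (V := V) (W := W) (s := Set.univ)).trans
      (VectorField.lieBracketWithin_univ (𝕜 := ℝ) (E := E) (V := V) (W := W))
  have key := VectorField.mpullback_mlieBracket (I := 𝓘(ℝ, E)) (I' := I) (n := ∞)
    (f := (extChartAt I x₀).symm) (V := X) (W := Y) (x₀ := extChartAt I x₀ y)
    (by rwa [heq]) (by rwa [heq]) (contMDiffAt_extChartAt_symm' hp)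
    hle
  rw [Filter.EventuallyEq.mlieBracket_vectorField_eq (hev X) (hev Y)] at key
  have key' : fieldCoord I x₀ (VectorField.mlieBracket I X Y) (extChartAt I x₀ y)
      = VectorField.lieBracket ℝ (fieldCoord I x₀ X) (fieldCoord I x₀ Y) (extChartAt I x₀ y) := by
    rw [← hpull _ hp]
    exact key.trans (congrFun (hlie _ _) _)
  rw [fieldCoord_extChartAt _ hy] at key'
  rw [key', VectorField.lieBracket, fieldCoord_extChartAt _ hy, fieldCoord_extChartAt _ hy]

lemma contMDiffAt_coordSymm {p : E} (hp : p ∈ (extChartAt I x₀).target) (u : E) :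
    ContMDiffAt 𝓘(ℝ, E) I.tangent ∞ (fun q ↦ (⟨(extChartAt I x₀).symm q,
      coordSymm I x₀ ((extChartAt I x₀).symm q) u⟩ : TangentBundle I M)) p := by
  have hz := (extChartAt I x₀).map_target hp
  rw [(trivializationAt E (TangentSpace I : M → Type _) x₀).contMDiffAt_iff
    (by simpa using hz)]
  refine ⟨contMDiffAt_extChartAt_symm' hp, ?_⟩
  refine (contMDiffAt_const (c := u)).congr_of_eventuallyEq ?_
  filter_upwards [(isOpen_extChartAt_target x₀).mem_nhds hp] with q hq
  rw [trivializationAt_eq_coordMap ((extChartAt I x₀).map_target hq),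
    coordMap_coordSymm ((extChartAt I x₀).map_target hq)]

omit [I.Boundaryless] in
lemma mdifferentiableAt_extendVec (v : TangentSpace I y) :
    MDifferentiableAt I I.tangent (fun z ↦ (⟨z, extendVec I v z⟩ : TangentBundle I M)) y :=
  FiberBundle.mdifferentiableAt_extend I E v

end ChartCoordinates

section LeviCivitaCoordinates

variable {E : Type*} [NormedAddCommGroup E] [NormedSpace ℝ E]
  {H : Type*} [TopologicalSpace H] (I : ModelWithCorners ℝ E H)
  {M : Type*} [TopologicalSpace M] [ChartedSpace H M] [IsManifold I ∞ M]
  [RiemannianBundle (fun x : M ↦ TangentSpace I x)]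

/-- The metric in the chart at `x₀`. -/
def metricCoord (x₀ : M) (p : E) : E →L[ℝ] E →L[ℝ] ℝ :=
  (innerSL ℝ (E := TangentSpace I ((extChartAt I x₀).symm p))).bilinearComp
    (coordSymm I x₀ ((extChartAt I x₀).symm p)) (coordSymm I x₀ ((extChartAt I x₀).symm p))

variable {I} {x₀ y : M}

lemma metricCoord_apply (p u v : E) : metricCoord I x₀ p u v
    = inner ℝ (coordSymm I x₀ ((extChartAt I x₀).symm p) u)
      (coordSymm I x₀ ((extChartAt I x₀).symm p) v) := rfl

lemma metricCoord_coordMap (hy : y ∈ (extChartAt I x₀).source) (u v : TangentSpace I y) :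
    metricCoord I x₀ (extChartAt I x₀ y) (coordMap I x₀ y u) (coordMap I x₀ y v) = inner ℝ u v := by
  rw [metricCoord_apply, (extChartAt I x₀).left_inv hy, coordSymm_coordMap hy,
    coordSymm_coordMap hy]

variable [FiniteDimensional ℝ E] [I.Boundaryless]
  [IsContMDiffRiemannianBundle I ∞ E (fun x : M ↦ TangentSpace I x)]

lemma isMetricOn_metricCoord (x₀ : M) :
    IsMetricOn (metricCoord I x₀) (extChartAt I x₀).target where
  isOpen := isOpen_extChartAt_target x₀
  contDiffAt := by
    suffices h : ContDiffOn ℝ ∞ (metricCoord I x₀) (extChartAt I x₀).target from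
      fun p hp ↦ h.contDiffAt ((isOpen_extChartAt_target x₀).mem_nhds hp)
    rw [contDiffOn_clm_apply]
    intro u
    rw [contDiffOn_clm_apply]
    intro v p hp
    refine ContDiffAt.contDiffWithinAt ?_
    rw [← contMDiffAt_iff_contDiffAt]
    exact ContMDiffAt.inner_bundle (IB := I) (F := E) (E := fun x : M ↦ TangentSpace I x)
      (b := (extChartAt I x₀).symm) (contMDiffAt_coordSymm hp u) (contMDiffAt_coordSymm hp v)
  symm p _ u v := by
    rw [metricCoord_apply, metricCoord_apply, real_inner_comm]
  pos p hp u hu := by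
    rw [metricCoord_apply]
    refine real_inner_self_pos.2 fun h ↦ hu ?_
    rw [← coordMap_coordSymm ((extChartAt I x₀).map_target hp) u, h, map_zero]

lemma mvfderiv_inner {Y Z : Π y : M, TangentSpace I y} (hy : y ∈ (extChartAt I x₀).source)
    (hY : MDifferentiableAt I I.tangent (fun z ↦ (⟨z, Y z⟩ : TangentBundle I M)) y)
    (hZ : MDifferentiableAt I I.tangent (fun z ↦ (⟨z, Z z⟩ : TangentBundle I M)) y)
    (v : TangentSpace I y) :
    mvfderiv I (fun z ↦ inner ℝ (Y z) (Z z)) y v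
      = fderiv ℝ (metricCoord I x₀) (extChartAt I x₀ y) (coordMap I x₀ y v)
          (coordMap I x₀ y (Y y)) (coordMap I x₀ y (Z y))
        + metricCoord I x₀ (extChartAt I x₀ y)
          (fderiv ℝ (fieldCoord I x₀ Y) (extChartAt I x₀ y) (coordMap I x₀ y v))
          (coordMap I x₀ y (Z y))
        + metricCoord I x₀ (extChartAt I x₀ y) (coordMap I x₀ y (Y y))
          (fderiv ℝ (fieldCoord I x₀ Z) (extChartAt I x₀ y) (coordMap I x₀ y v)) := by
  have hp := (extChartAt I x₀).map_source hy
  have hev : (fun z ↦ inner ℝ (Y z) (Z z)) ∘ (extChartAt I x₀).symm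
      =ᶠ[𝓝 (extChartAt I x₀ y)]
      fun q ↦ metricCoord I x₀ q (fieldCoord I x₀ Y q) (fieldCoord I x₀ Z q) := by
    filter_upwards [(isOpen_extChartAt_target x₀).mem_nhds hp] with q hq
    have hz := (extChartAt I x₀).map_target hq
    rw [metricCoord_apply, fieldCoord, fieldCoord, coordSymm_coordMap hz, coordSymm_coordMap hz]
    rfl
  have dY := ((mdifferentiableAt_field_iff Y hy).1 hY)
  have dZ := ((mdifferentiableAt_field_iff Z hy).1 hZ)
  have dg := (isMetricOn_metricCoord x₀).hasFDerivAt hp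
  have hd := hev.differentiableAt_iff.2 ((dg.differentiableAt.clm_apply dY).clm_apply dZ)
  rw [mvfderiv_eq_coord hy ((mdifferentiableAt_iff_coord hy).2 hd), hev.fderiv_eq,
    hasFDerivAt_bilin dg dY.hasFDerivAt dZ.hasFDerivAt, fieldCoord_extChartAt _ hy,
    fieldCoord_extChartAt _ hy]

/-- The Koszul formula in a chart. -/
lemma koszul_eq_coord {X Y Z : Π y : M, TangentSpace I y} (hy : y ∈ (extChartAt I x₀).source)
    (hX : MDifferentiableAt I I.tangent (fun z ↦ (⟨z, X z⟩ : TangentBundle I M)) y)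
    (hY : MDifferentiableAt I I.tangent (fun z ↦ (⟨z, Y z⟩ : TangentBundle I M)) y)
    (hZ : MDifferentiableAt I I.tangent (fun z ↦ (⟨z, Z z⟩ : TangentBundle I M)) y) :
    koszul I X Y Z y = metricCoord I x₀ (extChartAt I x₀ y)
      (fderiv ℝ (fieldCoord I x₀ Y) (extChartAt I x₀ y) (coordMap I x₀ y (X y))
        + christoffel (metricCoord I x₀) (extChartAt I x₀ y) (coordMap I x₀ y (X y))
          (coordMap I x₀ y (Y y)))
      (coordMap I x₀ y (Z y)) := by
  have hp := (extChartAt I x₀).map_source hy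
  have hg := isMetricOn_metricCoord (I := I) x₀
  have hs := hg.symm _ hp
  rw [koszul, mvfderiv_inner hy hY hZ, mvfderiv_inner hy hX hZ, mvfderiv_inner hy hX hY,
    ← metricCoord_coordMap hy, ← metricCoord_coordMap hy, ← metricCoord_coordMap hy,
    coordMap_mlieBracket hy hX hY, coordMap_mlieBracket hy hX hZ, coordMap_mlieBracket hy hY hZ,
    map_add, add_apply, hg.christoffel_spec hp, christoffelLower_apply]
  simp only [map_sub, sub_apply]
  rw [hs (coordMap I x₀ y (Y y)) (fderiv ℝ (fieldCoord I x₀ Z) _ _),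
    hs (coordMap I x₀ y (X y)) (fderiv ℝ (fieldCoord I x₀ Z) _ _),
    hs (coordMap I x₀ y (X y)) (fderiv ℝ (fieldCoord I x₀ Y) _ _)]
  ring

/-- The Levi-Civita connection in a chart. -/
lemma coordMap_leviCivita {Y : Π y : M, TangentSpace I y} (hy : y ∈ (extChartAt I x₀).source)
    (hY : MDifferentiableAt I I.tangent (fun z ↦ (⟨z, Y z⟩ : TangentBundle I M)) y)
    (v : TangentSpace I y) :
    coordMap I x₀ y (leviCivita I Y y v)
      = fderiv ℝ (fieldCoord I x₀ Y) (extChartAt I x₀ y) (coordMap I x₀ y v)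
        + christoffel (metricCoord I x₀) (extChartAt I x₀ y) (coordMap I x₀ y v)
          (coordMap I x₀ y (Y y)) := by
  let W : TangentSpace I y →L[ℝ] TangentSpace I y := coordSymm I x₀ y ∘L
    (fderiv ℝ (fieldCoord I x₀ Y) (extChartAt I x₀ y)
      + (christoffel (metricCoord I x₀) (extChartAt I x₀ y)).flip (coordMap I x₀ y (Y y))) ∘L
      coordMap I x₀ y
  have hW (u : TangentSpace I y) : coordMap I x₀ y (W u)
      = fderiv ℝ (fieldCoord I x₀ Y) (extChartAt I x₀ y) (coordMap I x₀ y u)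
        + christoffel (metricCoord I x₀) (extChartAt I x₀ y) (coordMap I x₀ y u)
          (coordMap I x₀ y (Y y)) := coordMap_coordSymm hy _
  rw [← hW]
  congr 1
  have hk (i j) : koszul I (extendVec I (tangentONB I y i)) Y (extendVec I (tangentONB I y j)) y
      = inner ℝ (W (tangentONB I y i)) (tangentONB I y j) := by
    rw [koszul_eq_coord hy (mdifferentiableAt_extendVec _) hY (mdifferentiableAt_extendVec _),
      ← metricCoord_coordMap hy, hW]
    simp only [extendVec, FiberBundle.extend_apply_self]
  simp only [leviCivita, hk, sum_apply, smul_apply, ContinuousLinearMap.smulRight_apply,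
    innerSL_apply_apply]
  rw [Finset.sum_comm]
  conv_rhs => rw [← (tangentONB I y).sum_repr' (W v)]
  refine Finset.sum_congr rfl fun j _ ↦ ?_
  conv_rhs => rw [← (tangentONB I y).sum_repr' v, map_sum, inner_sum]
  rw [Finset.sum_smul]
  refine Finset.sum_congr rfl fun i _ ↦ ?_
  rw [map_smul, inner_smul_right, smul_smul, real_inner_comm (W _), mul_comm]

end LeviCivitaCoordinates

section TensorCoordinates

variable {E : Type*} [NormedAddCommGroup E] [NormedSpace ℝ E]
  {H : Type*} [TopologicalSpace H] {I : ModelWithCorners ℝ E H}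
  {M : Type*} [TopologicalSpace M] [ChartedSpace H M] [IsManifold I ∞ M] {x₀ y : M}

lemma extendVec_eq (hy : y ∈ (extChartAt I x₀).source) (v : TangentSpace I x₀) :
    extendVec I v y = coordSymm I x₀ y (coordMap I x₀ x₀ v) := by
  rw [← trivializationAt_eq_coordMap (mem_extChartAt_source x₀), extendVec, FiberBundle.extend,
    coordSymm, Trivialization.symmL_apply _ (by simpa using hy)]

lemma fieldCoord_extendVec {p : E} (hp : p ∈ (extChartAt I x₀).target) (v : TangentSpace I x₀) :
    fieldCoord I x₀ (extendVec I v) p = coordMap I x₀ x₀ v := by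
  have hz := (extChartAt I x₀).map_target hp
  rw [fieldCoord, extendVec_eq hz, coordMap_coordSymm hz]

variable [I.Boundaryless]

lemma fieldCoord_extendVec_eventuallyEq {p : E} (hp : p ∈ (extChartAt I x₀).target)
    (v : TangentSpace I x₀) :
    fieldCoord I x₀ (extendVec I v) =ᶠ[𝓝 p] fun _ ↦ coordMap I x₀ x₀ v := by
  filter_upwards [(isOpen_extChartAt_target x₀).mem_nhds hp] with q hq
  exact fieldCoord_extendVec hq v

lemma fderiv_fieldCoord_extendVec {p : E} (hp : p ∈ (extChartAt I x₀).target)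
    (v : TangentSpace I x₀) : fderiv ℝ (fieldCoord I x₀ (extendVec I v)) p = 0 := by
  rw [(fieldCoord_extendVec_eventuallyEq hp v).fderiv_eq]
  simp

lemma mdifferentiableAt_extendVec_of_mem (hy : y ∈ (extChartAt I x₀).source)
    (v : TangentSpace I x₀) :
    MDifferentiableAt I I.tangent (fun z ↦ (⟨z, extendVec I v z⟩ : TangentBundle I M)) y := by
  rw [mdifferentiableAt_field_iff _ hy, (fieldCoord_extendVec_eventuallyEq
    ((extChartAt I x₀).map_source hy) v).differentiableAt_iff]
  exact differentiableAt_const _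

variable [FiniteDimensional ℝ E] [RiemannianBundle (fun x : M ↦ TangentSpace I x)]
  [IsContMDiffRiemannianBundle I ∞ E (fun x : M ↦ TangentSpace I x)]

lemma coordMap_leviCivita_extendVec (hy : y ∈ (extChartAt I x₀).source) (w : TangentSpace I x₀)
    (v : TangentSpace I y) :
    coordMap I x₀ y (leviCivita I (extendVec I w) y v)
      = christoffel (metricCoord I x₀) (extChartAt I x₀ y) (coordMap I x₀ y v)
        (coordMap I x₀ x₀ w) := by
  rw [coordMap_leviCivita hy (mdifferentiableAt_extendVec_of_mem hy w),
    fderiv_fieldCoord_extendVec ((extChartAt I x₀).map_source hy), extendVec_eq hy,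
    coordMap_coordSymm hy]
  simp

/-- The curvature tensor in a chart. -/
lemma coordMap_curvature (x₀ : M) (u v w : TangentSpace I x₀) :
    coordMap I x₀ x₀ (curvature I x₀ u v w)
      = curvatureCoord (christoffel (metricCoord I x₀)) (extChartAt I x₀ x₀)
        (coordMap I x₀ x₀ u) (coordMap I x₀ x₀ v) (coordMap I x₀ x₀ w) := by
  have hx := mem_extChartAt_source (I := I) x₀
  have hp := (extChartAt I x₀).map_source hx
  have hΓ := ((isMetricOn_metricCoord (I := I) x₀).contDiffAt_christoffel hp).differentiableAt
    (by simp)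
  have hself (a : TangentSpace I x₀) : extendVec I a x₀ = a := FiberBundle.extend_apply_self E a
  have hfield (a b : TangentSpace I x₀) :
      fieldCoord I x₀ (fun y ↦ leviCivita I (extendVec I b) y (extendVec I a y))
        =ᶠ[𝓝 (extChartAt I x₀ x₀)]
        fun q ↦ christoffel (metricCoord I x₀) q (coordMap I x₀ x₀ a) (coordMap I x₀ x₀ b) := by
    filter_upwards [(isOpen_extChartAt_target x₀).mem_nhds hp] with q hq
    have hz := (extChartAt I x₀).map_target hq
    rw [fieldCoord, coordMap_leviCivita_extendVec hz, extendVec_eq hz, coordMap_coordSymm hz,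
      (extChartAt I x₀).right_inv hq]
  have hd (a b : E) := (hΓ.hasFDerivAt.clm_apply
    (hasFDerivAt_const a _)).clm_apply (hasFDerivAt_const b _)
  have hD (a b c : TangentSpace I x₀) : coordMap I x₀ x₀
        (leviCivita I (fun y ↦ leviCivita I (extendVec I c) y (extendVec I b y)) x₀ a)
      = fderiv ℝ (christoffel (metricCoord I x₀)) (extChartAt I x₀ x₀) (coordMap I x₀ x₀ a)
          (coordMap I x₀ x₀ b) (coordMap I x₀ x₀ c)
        + christoffel (metricCoord I x₀) (extChartAt I x₀ x₀) (coordMap I x₀ x₀ a)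
          (christoffel (metricCoord I x₀) (extChartAt I x₀ x₀) (coordMap I x₀ x₀ b)
            (coordMap I x₀ x₀ c)) := by
    rw [coordMap_leviCivita hx, (hfield b c).fderiv_eq, (hd _ _).fderiv, hself,
      coordMap_leviCivita_extendVec hx]
    · simp
    · rw [mdifferentiableAt_field_iff _ hx, (hfield b c).differentiableAt_iff]
      exact (hd _ _).differentiableAt
  have hbr : VectorField.mlieBracket I (extendVec I u) (extendVec I v) x₀ = 0 := by
    rw [← coordSymm_coordMap hx (VectorField.mlieBracket I (extendVec I u) (extendVec I v) x₀),
      coordMap_mlieBracket hx (mdifferentiableAt_extendVec _) (mdifferentiableAt_extendVec _),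
      fderiv_fieldCoord_extendVec hp, fderiv_fieldCoord_extendVec hp]
    simp
  rw [curvature, hbr, map_zero, sub_zero, map_sub, hD, hD, curvatureCoord]
  abel

variable (I) in
/-- The components of a `(1,1)`-tensor field in the chart at `x₀`. -/
def tensorCoord (x₀ : M) (T : Π y : M, TangentSpace I y →L[ℝ] TangentSpace I y) (p : E) :
    E →L[ℝ] E :=
  coordMap I x₀ ((extChartAt I x₀).symm p) ∘L T ((extChartAt I x₀).symm p) ∘L
    coordSymm I x₀ ((extChartAt I x₀).symm p)

lemma coordMap_covDerivTensor {T : Π y : M, TangentSpace I y →L[ℝ] TangentSpace I y}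
    (hT : DifferentiableAt ℝ (tensorCoord I x₀ T) (extChartAt I x₀ x₀)) (v w : TangentSpace I x₀) :
    coordMap I x₀ x₀ (covDerivTensor I T x₀ v w)
      = fderiv ℝ (tensorCoord I x₀ T) (extChartAt I x₀ x₀) (coordMap I x₀ x₀ v)
          (coordMap I x₀ x₀ w)
        + christoffel (metricCoord I x₀) (extChartAt I x₀ x₀) (coordMap I x₀ x₀ v)
          (tensorCoord I x₀ T (extChartAt I x₀ x₀) (coordMap I x₀ x₀ w))
        - tensorCoord I x₀ T (extChartAt I x₀ x₀) (christoffel (metricCoord I x₀)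
            (extChartAt I x₀ x₀) (coordMap I x₀ x₀ v) (coordMap I x₀ x₀ w)) := by
  have hx := mem_extChartAt_source (I := I) x₀
  have hp := (extChartAt I x₀).map_source hx
  have hTx (a : TangentSpace I x₀) : coordMap I x₀ x₀ (T x₀ a)
      = tensorCoord I x₀ T (extChartAt I x₀ x₀) (coordMap I x₀ x₀ a) := by
    simp only [tensorCoord, ContinuousLinearMap.comp_apply]
    rw [(extChartAt I x₀).left_inv hx, coordSymm_coordMap hx]
  have hfield : fieldCoord I x₀ (fun y ↦ T y (extendVec I w y)) =ᶠ[𝓝 (extChartAt I x₀ x₀)]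
      fun q ↦ tensorCoord I x₀ T q (coordMap I x₀ x₀ w) := by
    filter_upwards [(isOpen_extChartAt_target x₀).mem_nhds hp] with q hq
    rw [fieldCoord, extendVec_eq ((extChartAt I x₀).map_target hq)]
    rfl
  have hd := hT.hasFDerivAt.clm_apply (hasFDerivAt_const (coordMap I x₀ x₀ w) _)
  rw [covDerivTensor, map_sub, coordMap_leviCivita hx, hfield.fderiv_eq, hd.fderiv, hTx, hTx,
    coordMap_leviCivita_extendVec hx, extendVec, FiberBundle.extend_apply_self]
  · simp
  · rw [mdifferentiableAt_field_iff _ hx, hfield.differentiableAt_iff]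
    exact hd.differentiableAt

end TensorCoordinates

section PullbackCoordinates

variable {E : Type*} [NormedAddCommGroup E] [NormedSpace ℝ E]
  {H : Type*} [TopologicalSpace H] {I : ModelWithCorners ℝ E H}
  {M : Type*} [TopologicalSpace M] [ChartedSpace H M] [IsManifold I ∞ M]
  {E' : Type*} [NormedAddCommGroup E'] [NormedSpace ℝ E']
  {H' : Type*} [TopologicalSpace H'] {J : ModelWithCorners ℝ E' H'}
  {N : Type*} [TopologicalSpace N] [ChartedSpace H' N] [IsManifold J ∞ N]
  {φ : M → N} {σ : Π x : M, TangentSpace J (φ x)} {x₀ x : M} {y₀ : N}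

variable (I J) in
/-- The map `φ` in the charts at `x₀` and `y₀`. -/
def mapCoord (x₀ : M) (y₀ : N) (φ : M → N) (p : E) : E' :=
  extChartAt J y₀ (φ ((extChartAt I x₀).symm p))

variable (I J) in
/-- The components of a vector field along `φ` in the charts at `x₀` and `y₀`. -/
def alongCoord (x₀ : M) (y₀ : N) (φ : M → N) (σ : Π x : M, TangentSpace J (φ x)) (p : E) : E' :=
  coordMap J y₀ (φ ((extChartAt I x₀).symm p)) (σ ((extChartAt I x₀).symm p))

omit [IsManifold I ∞ M] [IsManifold J ∞ N] in
lemma mapCoord_extChartAt (hx : x ∈ (extChartAt I x₀).source) :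
    mapCoord I J x₀ y₀ φ (extChartAt I x₀ x) = extChartAt J y₀ (φ x) := by
  rw [mapCoord, (extChartAt I x₀).left_inv hx]

omit [IsManifold I ∞ M] in
lemma alongCoord_extChartAt (hx : x ∈ (extChartAt I x₀).source) :
    alongCoord I J x₀ y₀ φ σ (extChartAt I x₀ x) = coordMap J y₀ (φ x) (σ x) := by
  rw [alongCoord, (extChartAt I x₀).left_inv hx]

variable [I.Boundaryless]

lemma contDiffAt_mapCoord (hx : x ∈ (extChartAt I x₀).source)
    (hφx : φ x ∈ (extChartAt J y₀).source) (hφ : ContMDiff I J ∞ φ) :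
    ContDiffAt ℝ ∞ (mapCoord I J x₀ y₀ φ) (extChartAt I x₀ x) := by
  rw [← contMDiffAt_iff_contDiffAt]
  have h1 := contMDiffAt_extChartAt_symm' ((extChartAt I x₀).map_source hx)
  have h2 : ContMDiffAt J 𝓘(ℝ, E') ∞ (extChartAt J y₀)
      (φ ((extChartAt I x₀).symm (extChartAt I x₀ x))) := by
    rw [(extChartAt I x₀).left_inv hx]
    exact contMDiffAt_extChartAt' (by simpa using hφx)
  exact h2.comp (extChartAt I x₀ x)
    (ContMDiffAt.comp (extChartAt I x₀ x) (I' := I) hφ.contMDiffAt h1)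

lemma coordMap_mfderiv (hx : x ∈ (extChartAt I x₀).source)
    (hφx : φ x ∈ (extChartAt J y₀).source) (hφ : MDifferentiableAt I J φ x)
    (v : TangentSpace I x) :
    coordMap J y₀ (φ x) (mfderiv I J φ x v)
      = fderiv ℝ (mapCoord I J x₀ y₀ φ) (extChartAt I x₀ x) (coordMap I x₀ x v) := by
  have hκ : MDifferentiableAt J 𝓘(ℝ, E') (extChartAt J y₀) (φ x) :=
    mdifferentiableAt_extChartAt (by simpa using hφx)
  have h := mvfderiv_eq_coord hx (hκ.comp x hφ) v
  refine Eq.trans ?_ h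
  rw [mvfderiv, mfderiv_comp x hκ hφ, coordMap_eq_mfderiv hφx]
  rfl

lemma contDiffAt_alongCoord (hx : x ∈ (extChartAt I x₀).source)
    (hφx : φ x ∈ (extChartAt J y₀).source)
    (hσ : ContMDiff I J.tangent ∞ (fun x ↦ (⟨φ x, σ x⟩ : TangentBundle J N))) :
    ContDiffAt ℝ ∞ (alongCoord I J x₀ y₀ φ σ) (extChartAt I x₀ x) := by
  rw [← contMDiffAt_iff_contDiffAt]
  have h1 := contMDiffAt_extChartAt_symm' ((extChartAt I x₀).map_source hx)
  have h2 := ContMDiffAt.comp (extChartAt I x₀ x) (I' := I) hσ.contMDiffAt h1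
  have hφ : ContinuousAt (fun p ↦ φ ((extChartAt I x₀).symm p)) (extChartAt I x₀ x) :=
    ((contMDiff_proj (TangentSpace J : N → Type _)).contMDiffAt.comp _ h2).continuousAt
  have hmem : ((extChartAt J y₀).source) ∈ 𝓝 (φ ((extChartAt I x₀).symm (extChartAt I x₀ x))) := by
    rw [(extChartAt I x₀).left_inv hx]
    exact extChartAt_source_mem_nhds' hφx
  have hbase : φ ((extChartAt I x₀).symm (extChartAt I x₀ x))
      ∈ (trivializationAt E' (TangentSpace J : N → Type _) y₀).baseSet := by
    rw [(extChartAt I x₀).left_inv hx]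
    simpa using hφx
  have h3 := (((trivializationAt E' (TangentSpace J : N → Type _) y₀).contMDiffAt_iff
    ((Trivialization.mem_source _).2 hbase)).1 h2).2
  refine h3.congr_of_eventuallyEq ?_
  filter_upwards [hφ.preimage_mem_nhds hmem] with p hp
  exact (trivializationAt_eq_coordMap hp _).symm

variable [J.Boundaryless] [FiniteDimensional ℝ E'] [RiemannianBundle (fun x : N ↦ TangentSpace J x)]
  [IsContMDiffRiemannianBundle J ∞ E' (fun x : N ↦ TangentSpace J x)]

/-- The induced connection along `φ` in charts. -/
lemma coordMap_pullbackConnection (hx : x ∈ (extChartAt I x₀).source)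
    (hφx : φ x ∈ (extChartAt J y₀).source)
    (hσ : ContMDiff I J.tangent ∞ (fun x ↦ (⟨φ x, σ x⟩ : TangentBundle J N)))
    (v : TangentSpace I x) :
    coordMap J y₀ (φ x) (pullbackConnection I J φ σ x v)
      = covDerivAlong (christoffel (metricCoord J y₀)) (mapCoord I J x₀ y₀ φ)
        (alongCoord I J x₀ y₀ φ σ) (extChartAt I x₀ x) (coordMap I x₀ x v) := by
  have hφ : ContMDiff I J ∞ φ := (contMDiff_proj (TangentSpace J : N → Type _)).comp hσ
  have hφd : MDifferentiableAt I J φ x := (hφ x).mdifferentiableAt (by simp)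
  have hz := mem_extChartAt_source (I := J) (φ x)
  have hq := (extChartAt J y₀).map_source hφx
  let e := trivializationAt E' (TangentSpace J : N → Type _) (φ x)
  let e' := trivializationAt E' (TangentSpace J : N → Type _) y₀
  let s : M → E' := fun y ↦ (e ⟨φ y, σ y⟩).2
  have hs : MDifferentiableAt I 𝓘(ℝ, E') s x :=
    ((e.contMDiffAt_iff (by simp [e])).1 (hσ x)).2.mdifferentiableAt (by simp)
  let C : E' → E' →L[ℝ] E' := fun q ↦ (e.coordChangeL ℝ e' ((extChartAt J y₀).symm q) : E' →L[ℝ] E')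
  have hC : DifferentiableAt ℝ C (extChartAt J y₀ (φ x)) := by
    refine (mdifferentiableAt_iff_coord (I := J)
      (h := fun y ↦ (e.coordChangeL ℝ e' y : E' →L[ℝ] E')) hφx).1 ?_
    exact mdifferentiableAt_coordChangeL (by simp [e]) (by simpa [e'] using hφx)
  have hCapply {y : N} (hy : y ∈ (extChartAt J (φ x)).source) (hy' : y ∈ (extChartAt J y₀).source)
      (b : E') : C (extChartAt J y₀ y) b = coordMap J y₀ y (coordSymm J (φ x) y b) := by
    have h1 : y ∈ e.baseSet := by simpa [e] using hy
    have h2 : y ∈ e'.baseSet := by simpa [e'] using hy'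
    simp only [C, (extChartAt J y₀).left_inv hy', ContinuousLinearEquiv.coe_coe]
    rw [Trivialization.coordChangeL_apply _ _ ⟨h1, h2⟩, coordSymm,
      Trivialization.symmL_apply _ h1, ← trivializationAt_eq_coordMap hy']
  have hsx : s x = coordMap J (φ x) (φ x) (σ x) := trivializationAt_eq_coordMap hz _
  have hW : fieldCoord J y₀ (extendVec J (σ x)) =ᶠ[𝓝 (extChartAt J y₀ (φ x))]
      fun q ↦ C q (s x) := by
    have hmem : (extChartAt J y₀).symm ⁻¹' (extChartAt J (φ x)).source
        ∈ 𝓝 (extChartAt J y₀ (φ x)) := by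
      refine (continuousAt_extChartAt_symm' hφx).preimage_mem_nhds ?_
      rw [(extChartAt J y₀).left_inv hφx]
      exact extChartAt_source_mem_nhds (φ x)
    filter_upwards [(isOpen_extChartAt_target y₀).mem_nhds hq, hmem] with q hq1 hq2
    have h := hCapply hq2 ((extChartAt J y₀).map_target hq1) (s x)
    rw [(extChartAt J y₀).right_inv hq1] at h
    rw [h, fieldCoord, extendVec_eq hq2, hsx]
  have hA : alongCoord I J x₀ y₀ φ σ =ᶠ[𝓝 (extChartAt I x₀ x)]
      fun p ↦ C (mapCoord I J x₀ y₀ φ p) ((s ∘ (extChartAt I x₀).symm) p) := by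
    have hcont : ContinuousAt (φ ∘ (extChartAt I x₀).symm) (extChartAt I x₀ x) :=
      hφ.continuous.continuousAt.comp (continuousAt_extChartAt_symm' hx)
    have hval : (φ ∘ (extChartAt I x₀).symm) (extChartAt I x₀ x) = φ x := by
      rw [Function.comp_apply, (extChartAt I x₀).left_inv hx]
    have h1 : (φ ∘ (extChartAt I x₀).symm) ⁻¹' (extChartAt J (φ x)).source
        ∈ 𝓝 (extChartAt I x₀ x) := by
      refine hcont.preimage_mem_nhds ?_
      rw [hval]
      exact extChartAt_source_mem_nhds (φ x)
    have h2 : (φ ∘ (extChartAt I x₀).symm) ⁻¹' (extChartAt J y₀).source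
        ∈ 𝓝 (extChartAt I x₀ x) := by
      refine hcont.preimage_mem_nhds ?_
      rw [hval]
      exact extChartAt_source_mem_nhds' hφx
    filter_upwards [h1, h2] with p hp1 hp2
    change φ ((extChartAt I x₀).symm p) ∈ (extChartAt J (φ x)).source at hp1
    change φ ((extChartAt I x₀).symm p) ∈ (extChartAt J y₀).source at hp2
    simp only [mapCoord, Function.comp_apply, alongCoord]
    rw [hCapply hp1 hp2, show s ((extChartAt I x₀).symm p) = coordMap J (φ x) _ (σ _) from
      trivializationAt_eq_coordMap hp1 _, coordSymm_coordMap hp1]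
  have hmap := ((contDiffAt_mapCoord hx hφx hφ).differentiableAt (by simp)).hasFDerivAt
  have hsd := ((mdifferentiableAt_iff_coord hx).1 hs).hasFDerivAt
  have hCd : HasFDerivAt C (fderiv ℝ C (extChartAt J y₀ (φ x)))
      (mapCoord I J x₀ y₀ φ (extChartAt I x₀ x)) := by
    rw [mapCoord_extChartAt hx]
    exact hC.hasFDerivAt
  have hAd := (hCd.comp _ hmap).clm_apply hsd
  have hWd := hC.hasFDerivAt.clm_apply (hasFDerivAt_const (s x) _)
  have hself : coordMap J y₀ (φ x) (extendVec J (σ x) (φ x)) = coordMap J y₀ (φ x) (σ x) := by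
    rw [extendVec, FiberBundle.extend_apply_self]
  have hfirst : coordMap J y₀ (φ x) (e.symmL ℝ (φ x) (mvfderiv I s x v))
      = C (extChartAt J y₀ (φ x)) (fderiv ℝ (s ∘ (extChartAt I x₀).symm) (extChartAt I x₀ x)
        (coordMap I x₀ x v)) := by
    rw [hCapply hz hφx, mvfderiv_eq_coord hx hs]
    rfl
  have hsκ : (s ∘ (extChartAt I x₀).symm) (extChartAt I x₀ x) = s x := by
    rw [Function.comp_apply, (extChartAt I x₀).left_inv hx]
  rw [pullbackConnection, add_apply, map_add, ContinuousLinearMap.comp_apply,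
    ContinuousLinearMap.comp_apply, hfirst, coordMap_leviCivita hφx
      (mdifferentiableAt_extendVec_of_mem hz _), hself, hW.fderiv_eq, hWd.fderiv,
    coordMap_mfderiv hx hφx hφd, covDerivAlong, hA.fderiv_eq, alongCoord_extChartAt hx,
    mapCoord_extChartAt hx]
  have hAe := hAd.fderiv
  simp only [Function.comp_apply] at hAe
  simp only [Function.comp_apply, hAe, add_apply, ContinuousLinearMap.flip_apply,
    ContinuousLinearMap.comp_apply, mapCoord_extChartAt hx, map_zero, zero_add, zero_apply,
    (extChartAt I x₀).left_inv hx]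
  abel

end PullbackCoordinates

section TensorAlgebra

variable {E : Type*} [NormedAddCommGroup E] [NormedSpace ℝ E]
  {H : Type*} [TopologicalSpace H] {I : ModelWithCorners ℝ E H}
  {M : Type*} [TopologicalSpace M] [ChartedSpace H M] [IsManifold I ∞ M]

lemma clmTrace_tensorCoord [FiniteDimensional ℝ E] {x₀ : M} {p : E}
    (hp : p ∈ (extChartAt I x₀).target) (T : Π y : M, TangentSpace I y →L[ℝ] TangentSpace I y) :
    clmTrace (tensorCoord I x₀ T p) = tangentTrace I (T ((extChartAt I x₀).symm p)) := by
  have hz := (extChartAt I x₀).map_target hp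
  let f : TangentSpace I ((extChartAt I x₀).symm p) →ₗ[ℝ] E :=
    (coordMap I x₀ ((extChartAt I x₀).symm p) ∘L T ((extChartAt I x₀).symm p) :
      TangentSpace I ((extChartAt I x₀).symm p) →L[ℝ] E)
  let k : E →ₗ[ℝ] TangentSpace I ((extChartAt I x₀).symm p) :=
    (coordSymm I x₀ ((extChartAt I x₀).symm p) : E →L[ℝ] _)
  have h := LinearMap.trace_comp_comm' f k
  have h1 : k ∘ₗ f = (T ((extChartAt I x₀).symm p) : _ →ₗ[ℝ] _) := by
    ext v
    exact coordSymm_coordMap hz _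
  rw [h1] at h
  rw [tangentTrace, h]
  rfl

lemma tensorCoord_mul {x₀ : M} {p : E} (hp : p ∈ (extChartAt I x₀).target)
    (S T : Π y : M, TangentSpace I y →L[ℝ] TangentSpace I y) :
    tensorCoord I x₀ (fun y ↦ S y * T y) p = tensorCoord I x₀ S p * tensorCoord I x₀ T p := by
  have hz := (extChartAt I x₀).map_target hp
  ext v
  simp only [tensorCoord, ContinuousLinearMap.comp_apply, mul_apply_eq_comp]
  rw [coordSymm_coordMap hz]

end TensorAlgebra

section ShapeOperator

variable {E : Type*} [NormedAddCommGroup E] [NormedSpace ℝ E] [FiniteDimensional ℝ E]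
  {H : Type*} [TopologicalSpace H] {I : ModelWithCorners ℝ E H}
  {M : Type*} [TopologicalSpace M] [ChartedSpace H M] [IsManifold I ∞ M]
  [RiemannianBundle (fun x : M ↦ TangentSpace I x)]
  {E' : Type*} [NormedAddCommGroup E'] [NormedSpace ℝ E'] [FiniteDimensional ℝ E']
  {H' : Type*} [TopologicalSpace H'] {J : ModelWithCorners ℝ E' H'}
  {N : Type*} [TopologicalSpace N] [ChartedSpace H' N] [IsManifold J ∞ N]
  [RiemannianBundle (fun x : N ↦ TangentSpace J x)]
  {φ : M → N} {η : Π x : M, TangentSpace J (φ x)}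

omit [IsManifold I ∞ M] in
lemma inner_shapeOperator (x : M) (v w : TangentSpace I x) :
    inner ℝ (shapeOperator I J φ η x v) w
      = -inner ℝ (pullbackConnection I J φ η x v) (mfderiv I J φ x w) := by
  rw [shapeOperator, neg_apply, inner_neg_left, sum_apply, sum_inner]
  conv_rhs => rw [← (tangentONB I x).sum_repr' w, map_sum, inner_sum]
  congr 1
  refine Finset.sum_congr rfl fun i _ ↦ ?_
  rw [ContinuousLinearMap.smulRight_apply, ContinuousLinearMap.comp_apply, innerSL_apply_apply,
    map_smul, inner_smul_left, inner_smul_right, real_inner_comm]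
  simp [mul_comm]

variable [I.Boundaryless] [J.Boundaryless]
  [IsContMDiffRiemannianBundle J ∞ E' (fun x : N ↦ TangentSpace J x)]

/-- The shape operator represents the second fundamental form in charts. -/
lemma metricCoord_shapeOperator (hη : IsUnitNormal I J φ η) (hφ : MDifferentiable I J φ) {x₀ x : M}
    (hx : x ∈ (extChartAt I x₀).source) (hφx : φ x ∈ (extChartAt J (φ x₀)).source) (v w : E) :
    metricCoord I x₀ (extChartAt I x₀ x)
        (tensorCoord I x₀ (shapeOperator I J φ η) (extChartAt I x₀ x) v) w
      = secondForm (metricCoord J (φ x₀)) (mapCoord I J x₀ (φ x₀) φ)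
        (alongCoord I J x₀ (φ x₀) φ η) (extChartAt I x₀ x) v w := by
  have hT : tensorCoord I x₀ (shapeOperator I J φ η) (extChartAt I x₀ x) v
      = coordMap I x₀ x (shapeOperator I J φ η x (coordSymm I x₀ x v)) := by
    simp only [tensorCoord, ContinuousLinearMap.comp_apply]
    rw [(extChartAt I x₀).left_inv hx]
  rw [hT]
  conv_lhs => rw [← coordMap_coordSymm hx w, metricCoord_coordMap hx, inner_shapeOperator,
    ← metricCoord_coordMap hφx, coordMap_pullbackConnection hx hφx hη.contMDiff,
    coordMap_mfderiv hx hφx (hφ x), coordMap_coordSymm hx, coordMap_coordSymm hx]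
  rw [secondForm, mapCoord_extChartAt hx]

variable [IsContMDiffRiemannianBundle I ∞ E (fun x : M ↦ TangentSpace I x)]

/-- A hypersurface in the charts at `x₀` and `φ x₀`. -/
lemma isHypersurfaceOn_coord (hφ : IsIsometricImmersion I J φ) (hη : IsUnitNormal I J φ η)
    (hdim : Module.finrank ℝ E' = Module.finrank ℝ E + 1) (x₀ : M) :
    IsHypersurfaceOn (metricCoord I x₀) (metricCoord J (φ x₀)) (mapCoord I J x₀ (φ x₀) φ)
      (alongCoord I J x₀ (φ x₀) φ η)
      ((extChartAt I x₀).target ∩ (extChartAt I x₀).symm ⁻¹' (φ ⁻¹' (extChartAt J (φ x₀)).source))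
      (extChartAt J (φ x₀)).target := by
  have hg := isMetricOn_metricCoord (I := I) x₀
  have hd (x : M) : MDifferentiableAt I J φ x := (hφ.contMDiff x).mdifferentiableAt (by simp)
  have hpt {p : E} (hp : p ∈ (extChartAt I x₀).target ∩
      (extChartAt I x₀).symm ⁻¹' (φ ⁻¹' (extChartAt J (φ x₀)).source)) :
      ∃ x, x ∈ (extChartAt I x₀).source ∧ φ x ∈ (extChartAt J (φ x₀)).source ∧
        extChartAt I x₀ x = p :=
    ⟨(extChartAt I x₀).symm p, (extChartAt I x₀).map_target hp.1, hp.2,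
      (extChartAt I x₀).right_inv hp.1⟩
  have hopen : IsOpen ((extChartAt I x₀).target ∩
      (extChartAt I x₀).symm ⁻¹' (φ ⁻¹' (extChartAt J (φ x₀)).source)) :=
    (continuousOn_extChartAt_symm x₀).isOpen_inter_preimage (isOpen_extChartAt_target x₀)
      ((isOpen_extChartAt_source (φ x₀)).preimage hφ.contMDiff.continuous)
  refine ⟨⟨hopen, fun p hp ↦ hg.contDiffAt p hp.1, fun p hp ↦ hg.symm p hp.1,
    fun p hp ↦ hg.pos p hp.1⟩, isMetricOn_metricCoord _, ?_, ?_, ?_, ?_, ?_, ?_, hdim⟩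
  · exact fun p hp ↦ (extChartAt J (φ x₀)).map_source hp.2
  · intro p hp
    obtain ⟨x, hx, hφx, rfl⟩ := hpt hp
    exact contDiffAt_mapCoord hx hφx hφ.contMDiff
  · intro p hp
    obtain ⟨x, hx, hφx, rfl⟩ := hpt hp
    exact contDiffAt_alongCoord hx hφx hη.contMDiff
  · intro p hp u v
    obtain ⟨x, hx, hφx, rfl⟩ := hpt hp
    rw [← coordMap_coordSymm hx u, ← coordMap_coordSymm hx v, ← coordMap_mfderiv hx hφx (hd x),
      ← coordMap_mfderiv hx hφx (hd x), mapCoord_extChartAt hx, metricCoord_coordMap hφx,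
      metricCoord_coordMap hx, hφ.inner_mfderiv]
  · intro p hp
    obtain ⟨x, hx, hφx, rfl⟩ := hpt hp
    rw [mapCoord_extChartAt hx, alongCoord_extChartAt hx, metricCoord_coordMap hφx, hη.inner_self]
  · intro p hp v
    obtain ⟨x, hx, hφx, rfl⟩ := hpt hp
    rw [← coordMap_coordSymm hx v, ← coordMap_mfderiv hx hφx (hd x),
      mapCoord_extChartAt hx, alongCoord_extChartAt hx, metricCoord_coordMap hφx, hη.inner_mfderiv]

/-- The curvature tensor of a space form in a chart. -/
lemma HasConstantSectionalCurvature.curvatureCoord_eq {c : ℝ}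
    (hc : HasConstantSectionalCurvature I M c) (x₀ : M) (u v w z : E) :
    metricCoord I x₀ (extChartAt I x₀ x₀)
        (curvatureCoord (christoffel (metricCoord I x₀)) (extChartAt I x₀ x₀) u v w) z
      = c * (metricCoord I x₀ (extChartAt I x₀ x₀) v w * metricCoord I x₀ (extChartAt I x₀ x₀) u z
        - metricCoord I x₀ (extChartAt I x₀ x₀) u w
          * metricCoord I x₀ (extChartAt I x₀ x₀) v z) := by
  have hx := mem_extChartAt_source (I := I) x₀
  refine (isMetricOn_metricCoord (I := I) x₀).curvatureCoord_of_sectional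
    ((extChartAt I x₀).map_source hx) c (fun a b hab ↦ ?_) u v w z
  obtain ⟨a, rfl⟩ : ∃ a', coordMap I x₀ x₀ a' = a := ⟨_, coordMap_coordSymm hx a⟩
  obtain ⟨b, rfl⟩ : ∃ b', coordMap I x₀ x₀ b' = b := ⟨_, coordMap_coordSymm hx b⟩
  have hli : LinearIndependent ℝ ![a, b] := by
    rw [LinearIndependent.pair_iff] at hab ⊢
    intro s t hst
    refine hab s t ?_
    rw [← map_smul, ← map_smul, ← map_add, hst, map_zero]
  have h := hc x₀ a b hli
  rw [← coordMap_curvature, metricCoord_coordMap hx, metricCoord_coordMap hx,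
    metricCoord_coordMap hx, metricCoord_coordMap hx]
  have hne : inner ℝ a a * inner ℝ b b - inner ℝ a b ^ 2 ≠ 0 := by
    intro h0
    have hz : (inner ℝ b b : ℝ) • a + (-inner ℝ a b : ℝ) • b = 0 := by
      rw [← inner_self_eq_zero (𝕜 := ℝ)]
      simp only [inner_add_left, inner_add_right, real_inner_smul_left, real_inner_smul_right]
      rw [real_inner_comm a b]
      linear_combination (inner ℝ b b) * h0
    have hb := (LinearIndependent.pair_iff.1 hli _ _ hz).1
    exact hli.ne_zero 1 (inner_self_eq_zero.1 hb)
  rw [sectionalCurvature, div_eq_iff hne] at h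
  exact h

/-- The third Newton transformation of the shape operator of a hypersurface of a space form is
divergence-free. -/
theorem divTensor_newtonTransformation₃ {c : ℝ} (hN : HasConstantSectionalCurvature J N c)
    (hφ : IsIsometricImmersion I J φ) (hη : IsUnitNormal I J φ η)
    (hdim : Module.finrank ℝ E' = Module.finrank ℝ E + 1)
    {A T : Π x : M, TangentSpace I x →L[ℝ] TangentSpace I x} (hA : A = shapeOperator I J φ η)
    (hT : ∀ x, T x = ((1 / 6 : ℝ) * tangentTrace I (A x) ^ 3
        + (1 / 3 : ℝ) * tangentTrace I (A x * A x * A x)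
        - (1 / 2 : ℝ) * tangentTrace I (A x) * tangentTrace I (A x * A x)) • 1
      - ((1 / 2 : ℝ) * (tangentTrace I (A x) ^ 2 - tangentTrace I (A x * A x))) • A x
      + tangentTrace I (A x) • (A x * A x) - A x * A x * A x) (x₀ : M) :
    divTensor I T x₀ = 0 := by
  subst hA
  have hx := mem_extChartAt_source (I := I) x₀
  have hp := (extChartAt I x₀).map_source hx
  have hyp := isHypersurfaceOn_coord hφ hη hdim x₀
  have hpU : extChartAt I x₀ x₀ ∈ (extChartAt I x₀).target ∩
      (extChartAt I x₀).symm ⁻¹' (φ ⁻¹' (extChartAt J (φ x₀)).source) := by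
    refine ⟨hp, ?_⟩
    rw [Set.mem_preimage, (extChartAt I x₀).left_inv hx]
    exact mem_extChartAt_source (φ x₀)
  have hshape : ∀ q ∈ (extChartAt I x₀).target ∩
      (extChartAt I x₀).symm ⁻¹' (φ ⁻¹' (extChartAt J (φ x₀)).source), ∀ v w,
      metricCoord I x₀ q (tensorCoord I x₀ (shapeOperator I J φ η) q v) w
        = secondForm (metricCoord J (φ x₀)) (mapCoord I J x₀ (φ x₀) φ)
          (alongCoord I J x₀ (φ x₀) φ η) q v w := by
    intro q hq v w
    have h := metricCoord_shapeOperator hη (hφ.contMDiff.mdifferentiable (by simp))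
      ((extChartAt I x₀).map_target hq.1) hq.2 v w
    rwa [(extChartAt I x₀).right_inv hq.1] at h
  have hTcoord {q : E} (hq : q ∈ (extChartAt I x₀).target) : tensorCoord I x₀ T q
      = newtonTransformation₃ (tensorCoord I x₀ (shapeOperator I J φ η) q) := by
    have hz := (extChartAt I x₀).map_target hq
    rw [newtonTransformation₃, newtonSigma₂, newtonSigma₃, ← tensorCoord_mul hq,
      ← tensorCoord_mul hq, clmTrace_tensorCoord hq, clmTrace_tensorCoord hq,
      clmTrace_tensorCoord hq]
    ext v
    simp only [tensorCoord, hT, ContinuousLinearMap.comp_apply, add_apply, sub_apply, smul_apply,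
      one_apply_eq_self, map_add, map_sub, map_smul, coordMap_coordSymm hz]
  have hev : tensorCoord I x₀ T =ᶠ[𝓝 (extChartAt I x₀ x₀)]
      fun q ↦ newtonTransformation₃ (tensorCoord I x₀ (shapeOperator I J φ η) q) := by
    filter_upwards [(isOpen_extChartAt_target x₀).mem_nhds hp] with q hq using hTcoord hq
  have hAd := (((hyp.contDiffOn_shape hshape).contDiffAt
    (hyp.metric.isOpen.mem_nhds hpU)).differentiableAt (by simp)).hasFDerivAt
  have hTd : DifferentiableAt ℝ (tensorCoord I x₀ T) (extChartAt I x₀ x₀) :=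
    hev.differentiableAt_iff.2 (hasFDerivAt_newtonTransformation₃ hAd 0).1
  let L : TangentSpace I x₀ ≃ₗ[ℝ] E := LinearEquiv.ofLinearMap
    (coordMap I x₀ x₀ : TangentSpace I x₀ →ₗ[ℝ] E) (coordSymm I x₀ x₀ : E →ₗ[ℝ] TangentSpace I x₀)
    (by ext v; exact coordMap_coordSymm hx v) (by ext v; exact coordSymm_coordMap hx v)
  let b := (tangentONB I x₀).toBasis.map L
  have hb (i) : b i = coordMap I x₀ x₀ (tangentONB I x₀ i) := by
    simp only [b, Module.Basis.map_apply, OrthonormalBasis.coe_toBasis]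
    rfl
  have hφ₀ : mapCoord I J x₀ (φ x₀) φ (extChartAt I x₀ x₀) = extChartAt J (φ x₀) (φ x₀) :=
    mapCoord_extChartAt hx
  have key := hyp.divergence_newtonTransformation₃_eq_zero hpU (c := c)
    (by rw [hφ₀]; exact hN.curvatureCoord_eq (φ x₀)) hshape b (fun i j ↦ by
      rw [hb, hb, metricCoord_coordMap hx]
      exact orthonormal_iff_ite.1 (tangentONB I x₀).orthonormal i j)
  refine L.injective ?_
  rw [map_zero, ← key, divTensor, map_sum]
  refine Finset.sum_congr rfl fun i _ ↦ ?_
  refine (coordMap_covDerivTensor hTd _ _).trans ?_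
  rw [hev.fderiv_eq, hTcoord hp, hb]

end ShapeOperator

end RiemannianGeometry

end

theorem lemma3p4 {m : ℕ}
    -- `M` is an `m`-dimensional and `N` an `(m + 1)`-dimensional smooth Riemannian manifold
    {M : Type*} [TopologicalSpace M] [ChartedSpace (EuclideanSpace ℝ (Fin m)) M]
    [IsManifold (𝓡 m) ∞ M] [RiemannianBundle (fun x : M ↦ TangentSpace (𝓡 m) x)]
    [IsContMDiffRiemannianBundle (𝓡 m) ∞ (EuclideanSpace ℝ (Fin m))
      (fun x : M ↦ TangentSpace (𝓡 m) x)]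
    {N : Type*} [TopologicalSpace N] [ChartedSpace (EuclideanSpace ℝ (Fin (m + 1))) N]
    [IsManifold (𝓡 (m + 1)) ∞ N] [RiemannianBundle (fun y : N ↦ TangentSpace (𝓡 (m + 1)) y)]
    [IsContMDiffRiemannianBundle (𝓡 (m + 1)) ∞ (EuclideanSpace ℝ (Fin (m + 1)))
      (fun y : N ↦ TangentSpace (𝓡 (m + 1)) y)]
    -- `N` is a space form
    (c : ℝ) (hN : RiemannianGeometry.HasConstantSectionalCurvature (𝓡 (m + 1)) N c)
    -- `φ : M → N` is a hypersurface with unit normal field `η`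
    (φ : M → N) (hφ : RiemannianGeometry.IsIsometricImmersion (𝓡 m) (𝓡 (m + 1)) φ)
    (η : Π x : M, TangentSpace (𝓡 (m + 1)) (φ x))
    (hη : RiemannianGeometry.IsUnitNormal (𝓡 m) (𝓡 (m + 1)) φ η)
    -- the shape operator, the mean curvature function, and `|A|² = tr A²`
    (A : Π x : M, TangentSpace (𝓡 m) x →L[ℝ] TangentSpace (𝓡 m) x)
    (hA : A = RiemannianGeometry.shapeOperator (𝓡 m) (𝓡 (m + 1)) φ η)
    (f normSqA ψ₂ ψ₃ : M → ℝ)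
    (hf : ∀ x, f x = (1 / m : ℝ) * RiemannianGeometry.tangentTrace (𝓡 m) (A x))
    (hnormSqA : ∀ x, normSqA x = RiemannianGeometry.tangentTrace (𝓡 m) (A x ^ 2))
    (hψ₃ : ∀ x, ψ₃ x = (1 / 6 : ℝ) * m ^ 3 * f x ^ 3
      + (1 / 3 : ℝ) * RiemannianGeometry.tangentTrace (𝓡 m) (A x ^ 3)
      - (1 / 2 : ℝ) * m * f x * normSqA x)
    (hψ₂ : ∀ x, ψ₂ x = (1 / 2 : ℝ) * (m ^ 2 * f x ^ 2 - normSqA x)) :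
    ∀ x : M, RiemannianGeometry.divTensor (𝓡 m)
      (fun y ↦ ψ₃ y • ContinuousLinearMap.id ℝ (TangentSpace (𝓡 m) y) - ψ₂ y • A y
        + (m * f y) • A y ^ 2 - A y ^ 3) x = 0 := by
  have hmf (x : M) : (m : ℝ) * f x = RiemannianGeometry.tangentTrace (𝓡 m) (A x) := by
    rw [hf]
    rcases Nat.eq_zero_or_pos m with rfl | hm
    · have : Subsingleton (TangentSpace (𝓡 0) x) :=
        inferInstanceAs (Subsingleton (EuclideanSpace ℝ (Fin 0)))
      have h0 : A x = 0 := by ext v; exact Subsingleton.elim _ _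
      simp [h0, RiemannianGeometry.tangentTrace]
    · have : (m : ℝ) ≠ 0 := by positivity
      field_simp
  refine RiemannianGeometry.divTensor_newtonTransformation₃ hN hφ hη (by simp) hA fun x ↦ ?_
  have h2 : A x ^ 2 = A x * A x := pow_two _
  have h3 : A x ^ 3 = A x * A x * A x := pow_three' _
  rw [hmf, hψ₂, hψ₃, hnormSqA, ← mul_pow, hmf, h2, h3,
    show (1 / 6 : ℝ) * m ^ 3 * f x ^ 3 = (1 / 6 : ℝ) * (m * f x) ^ 3 by ring,
    mul_assoc (1 / 2 : ℝ) (m : ℝ), hmf]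
  rfl
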